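/- For integers $n,p\ge 1$ and $z\in\mathbb{C}\setminus[1,\infty)$ let $$S_{n,p}(z)=\frac{(-1)^{n+p-1}}{(n-1)!\,p!}\int_0^1\log^{n-1}(t)\,\log^p(1-zt)\,\frac{dt}{t}$$ be the Nielsen polylogarithm, and let $\mathrm{Li}_m$ be the classical polylogarithm on $\mathbb{C}\setminus[1,\infty)$, given by $\mathrm{Li}_1(z)=-\log(1-z)$ and $\mathrm{Li}_m(z)=\int_0^z \mathrm{Li}_{m-1}(t)\,\frac{dt}{t}$ for $m\ge 2$ (integral along the straight segment from $0$ to $z$); $\log$ denotes the principal branch and $\zeta$ the Riemann zeta function. Proposition. For all $z\in\mathbb{C}\setminus\big((-\infty,0]\cup[1,\infty)\big)$, $$\begin{aligned} S_{3,3}(z)={}& S_{4,2}(z)-S_{4,2}(1-z)+\mathrm{Li}_6(1-z)-\mathrm{Li}_6(z)-\mathrm{Li}_6\Big(\frac{z}{z-1}\Big)-S_{3,2}(z)\log(1-z)\\ &+\mathrm{Li}_5(z)\log(1-z)-\mathrm{Li}_5(1-z)\log(z)-\frac{1}{2!}\mathrm{Li}_4(z)\log^2(1-z)\\ &-\frac{1}{6!}\log^6(1-z)+\frac{1}{5!}\log(z)\log^5(1-z)-\frac{1}{2!\,4!}\log^2(z)\log^4(1-z)\\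 &-\frac{1}{4!}\zeta(2)\log^4(1-z)+\frac{1}{3!}\zeta(2)\log(z)\log^3(1-z)+\frac{1}{2!}\zeta(3)\log(z)\log^2(1-z)\\ &+\zeta(4)\log(z)\log(1-z)-\frac{3}{4\cdot 2!}\zeta(4)\log^2(1-z)+\zeta(5)\log(z)\\ &+\big(\zeta(5)-\zeta(2)\zeta(3)\big)\log(1-z)-\Big(\frac14\zeta(6)+\frac12\zeta(3)^2\Big). \end{aligned}$$ Thus $S_{3,3}$ is expressed through the Nielsen polylogarithms $S_{4,2}$ and $S_{3,2}$ (of depth at most $2$), classical polylogarithms, logarithms and zeta values. -/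

import Mathlib

/-- The principal branch of the classical polylogarithm `Li_m` on `ℂ ∖ [1, ∞)`, given by
`Li_1(z) = -log(1 - z)` and `Li_m(z) = ∫_0^z Li_{m-1}(t) dt/t`, the integral being taken along the
straight segment `t = s z`, `0 ≤ s ≤ 1` (so that `dt/t = ds/s`).
The value at `m = 0` is the usual one, `Li_0(z) = z / (1 - z)`. -/
noncomputable def classicalLi : ℕ → ℂ → ℂ
  | 0, z => z / (1 - z)
  | 1, z => -Complex.log (1 - z)
  | m + 2, z => ∫ s in (0 : ℝ)..1, classicalLi (m + 1) ((s : ℂ) * z) / (s : ℂ)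

/-- The principal branch of the Nielsen polylogarithm `S_{n,p}`, for `n, p ≥ 1`, on
`ℂ ∖ [1, ∞)`:
`S_{n,p}(z) = (-1)^(n+p-1) / ((n-1)! p!) * ∫_0^1 log(t)^(n-1) log(1 - z t)^p dt/t`. -/
noncomputable def nielsenS (n p : ℕ) (z : ℂ) : ℂ :=
  (-1 : ℂ) ^ (n + p - 1) / ((Nat.factorial (n - 1) : ℂ) * (Nat.factorial p : ℂ)) *
    ∫ t in (0 : ℝ)..1,
      (Real.log t : ℂ) ^ (n - 1) * Complex.log (1 - z * (t : ℂ)) ^ p / (t : ℂ)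

/-- The doubly cut plane `ℂ ∖ ((-∞, 0] ∪ [1, ∞))`. -/
def cutPlane : Set ℂ :=
  (((↑) : ℝ → ℂ) '' (Set.Iic 0 ∪ Set.Ici 1))ᶜ

/-! ### Euler's evaluation of the double sums ζ(c,1), and the even zeta values needed. -/

section DoubleSums

open scoped ENNReal

/-! The identity is the top of a ladder of functional equations of weights 2 to 6 among the
functions `S_{n,p}` at `z`, `1 - z` and `z / (z - 1)`. Each equation is proved by differentiation:
`S_{n+1,p}` has derivative `S_{n,p} / z` (`hasDerivAt_nielsenS_succ`), with analogues at the other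
two arguments. So the derivative of the discrepancy between the two sides is a combination, with
coefficients `±1/z` and `±1/(1-z)`, of discrepancies one weight lower, hence zero; in weight 2 it
vanishes outright or by the Landen relation of the same weight. The doubly cut plane is star-shaped
about 1/2, so the discrepancy is constant, and it is identified by letting `z` tend to 0 along the
positive reals (`eq_zero_of_hasDerivAt_zero`).

Two matters need analysis. The limits of `S_{n,p}(1 - z)` are values at the branch point 1:
`S_{n,1}(1) = ζ(n+1)`, while `S_{n,2}(1)` is the double sum ζ(n+1,1), which Euler's partial fraction
and stuffle relations reduce to zeta values. Also, products such as `log z * (Li_5(1-z) - ζ(5))`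
must tend to 0, where mere convergence of the second factor is not enough. The class `LogSmall`
handles this: once a reflection formula is proved, its explicit side shows that the difference from
the value at 1 beats every power of the logarithm.

`S_{3,3}(z)` enters as a primitive of `S_{2,3}(z) / z`, since `S_{2,3}(z)` occurs in the reflection
formula for `Li_5`. The weight 6 relation `nielsenS_four_two_reflection` is linear in it, and
solving for it gives the theorem. -/

/-- The Dirichlet series `∑ 1 / n ^ s` over `n ≥ 1`, with values in `[0, ∞]`. -/
noncomputable def dirichletSum (s : ℕ) : ℝ≥0∞ :=
  ∑' i : ℕ, ENNReal.ofReal (1 / (i + 1 : ℝ) ^ s)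

/-- The Tornheim double series `∑ 1 / (m ^ a n ^ b (m + n) ^ c)` over `m, n ≥ 1`, with values in
`[0, ∞]`. -/
noncomputable def tornheimSum (a b c : ℕ) : ℝ≥0∞ :=
  ∑' (i : ℕ) (j : ℕ),
    ENNReal.ofReal (1 / ((i + 1 : ℝ) ^ a * (j + 1 : ℝ) ^ b * (i + j + 2 : ℝ) ^ c))

theorem tornheimSum_comm (a b c : ℕ) : tornheimSum a b c = tornheimSum b a c := by
  unfold tornheimSum
  rw [ENNReal.tsum_comm]
  refine tsum_congr fun i => tsum_congr fun j => ?_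
  congr 2
  ring

/-- Partial fractions: 1/(mn) = 1/(n(m+n)) + 1/(m(m+n)). Values in `[0, ∞]` make this and the
rearrangements below free of convergence hypotheses. -/
theorem tornheimSum_succ_succ (a b c : ℕ) :
    tornheimSum (a + 1) (b + 1) c = tornheimSum a (b + 1) (c + 1) + tornheimSum (a + 1) b (c + 1) := by
  unfold tornheimSum
  simp_rw [← ENNReal.tsum_add]
  refine tsum_congr fun i => tsum_congr fun j => ?_
  rw [← ENNReal.ofReal_add (by positivity) (by positivity)]
  congr 1
  field_simp
  ring

theorem tornheimSum_zero_right (a b : ℕ) :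
    tornheimSum a b 0 = dirichletSum a * dirichletSum b := by
  unfold tornheimSum dirichletSum
  rw [← ENNReal.tsum_mul_right]
  refine tsum_congr fun i => ?_
  rw [← ENNReal.tsum_mul_left]
  refine tsum_congr fun j => ?_
  rw [← ENNReal.ofReal_mul (by positivity)]
  congr 1
  simp [mul_comm]

/-- Trichotomy of the index pair. The shift by `k + 1` parametrizes the strict inequality, which is
what turns the off-diagonal pieces into Tornheim sums with one zero exponent. -/
theorem ENNReal.tsum_tsum_eq_lt_add_eq_add_gt (f : ℕ → ℕ → ℝ≥0∞) :
    ∑' (i : ℕ) (j : ℕ), f i j =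
      ∑' (i : ℕ) (k : ℕ), f i (i + k + 1) + ∑' (j : ℕ) (k : ℕ), f (j + k + 1) j + ∑' i, f i i := by
  have key : ∀ (g : ℕ → ℝ≥0∞) (i : ℕ), ∑' k, g (i + k + 1) = ∑' j, if i < j then g j else 0 := by
    intro g i
    have hinj : Function.Injective fun k : ℕ => i + k + 1 := fun a b h => by
      simpa using h
    rw [← hinj.tsum_eq (f := fun j => if i < j then g j else 0)]
    · refine tsum_congr fun k => ?_
      rw [if_pos (by omega)]
    · intro j hj
      have : i < j := by
        by_contra h
        simp [h] at hj
      exact ⟨j - i - 1, by simp only; omega⟩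
  have h1 : ∑' (j : ℕ) (k : ℕ), f (j + k + 1) j = ∑' (i : ℕ) (j : ℕ), if j < i then f i j else 0 := by
    rw [ENNReal.tsum_comm (f := fun i j => if j < i then f i j else 0)]
    exact tsum_congr fun j => key (fun i => f i j) j
  have h2 : ∑' (i : ℕ) (k : ℕ), f i (i + k + 1) = ∑' (i : ℕ) (j : ℕ), if i < j then f i j else 0 :=
    tsum_congr fun i => key (f i) i
  have h3 : ∑' i, f i i = ∑' (i : ℕ) (j : ℕ), if j = i then f i j else 0 :=
    tsum_congr fun i => by rw [tsum_ite_eq]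
  rw [h1, h2, h3, ← ENNReal.tsum_add, ← ENNReal.tsum_add]
  refine tsum_congr fun i => ?_
  rw [← ENNReal.tsum_add, ← ENNReal.tsum_add]
  refine tsum_congr fun j => ?_
  rcases lt_trichotomy i j with h | h | h
  · simp [h, h.not_gt, h.ne']
  · simp [h]
  · simp [h, h.not_gt, h.ne]

/-- The stuffle product of two Dirichlet series. -/
theorem dirichletSum_mul (a b : ℕ) :
    dirichletSum a * dirichletSum b =
      tornheimSum a 0 b + tornheimSum b 0 a + dirichletSum (a + b) := by
  rw [← tornheimSum_zero_right, tornheimSum, ENNReal.tsum_tsum_eq_lt_add_eq_add_gt]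
  unfold tornheimSum dirichletSum
  congr 2
  · refine tsum_congr fun i => tsum_congr fun j => ?_
    push_cast
    congr 2
    ring
  · refine tsum_congr fun i => tsum_congr fun j => ?_
    push_cast
    congr 2
    ring
  · funext i
    congr 2
    ring

theorem hasSum_inv_sub_inv_succ (c : ℝ) (hc : 0 < c) :
    HasSum (fun j : ℕ => 1 / (j + c) - 1 / (j + 1 + c)) (1 / c) := by
  rw [hasSum_iff_tendsto_nat_of_nonneg]
  · have h1 : ∀ n : ℕ, ∑ j ∈ Finset.range n, (1 / (j + c) - 1 / (j + 1 + c)) = 1 / c - 1 / (n + c) := by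
      intro n
      have := Finset.sum_range_sub' (fun j : ℕ => 1 / ((j : ℝ) + c)) n
      push_cast at this
      simpa using this
    simp_rw [h1]
    have : Filter.Tendsto (fun n : ℕ => 1 / ((n : ℝ) + c)) Filter.atTop (nhds 0) := by
      simp_rw [one_div]
      exact Filter.Tendsto.inv_tendsto_atTop
        (Filter.tendsto_atTop_add_const_right _ _ tendsto_natCast_atTop_atTop)
    simpa using tendsto_const_nhds.sub this
  · intro j
    rw [sub_nonneg]
    exact one_div_le_one_div_of_le (by positivity) (by linarith)

/-- With m = i + 1 the summand is 1/n - 1/(n+m), so the series telescopes to the harmonic number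
H_m; the induction adds one telescoping series at a time. -/
theorem hasSum_harmonic (i : ℕ) :
    HasSum (fun j : ℕ => (i + 1 : ℝ) / ((j + 1) * (i + j + 2)))
      (∑ k ∈ Finset.range (i + 1), 1 / (k + 1 : ℝ)) := by
  induction i with
  | zero =>
    convert! hasSum_inv_sub_inv_succ 1 one_pos using 1
    · funext j
      have : (j : ℝ) + 1 + 1 ≠ 0 := by positivity
      push_cast
      field_simp
      ring
    · simp
  | succ i ih =>
    rw [Finset.sum_range_succ]
    convert! ih.add (hasSum_inv_sub_inv_succ (i + 2 : ℝ) (by positivity)) using 1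
    · funext j
      push_cast
      field_simp
      ring
    · push_cast
      ring

/-- Summing over n first replaces the inner series by H_m / m. Splitting the harmonic number into k
< m and k = m then yields a double sum and a diagonal term. Compared with the expansion by
`tornheimSum_succ_succ`, this is Euler's sum formula. -/
theorem tornheimSum_succ_one_one (q : ℕ) :
    tornheimSum (q + 1) 1 1 = tornheimSum 1 0 (q + 2) + dirichletSum (q + 3) := by
  have h1 : ∀ i : ℕ, ∑' j : ℕ,
      ENNReal.ofReal (1 / ((i + 1 : ℝ) ^ (q + 1) * (j + 1 : ℝ) ^ 1 * (i + j + 2 : ℝ) ^ 1)) =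
      ∑ k ∈ Finset.range (i + 1), ENNReal.ofReal (1 / ((k + 1) * (i + 1 : ℝ) ^ (q + 2))) := by
    intro i
    have h := (hasSum_harmonic i).mul_left (1 / (i + 1 : ℝ) ^ (q + 2))
    rw [← ENNReal.ofReal_sum_of_nonneg (fun _ _ => by positivity)]
    have h' : ∑ k ∈ Finset.range (i + 1), 1 / ((k + 1) * (i + 1 : ℝ) ^ (q + 2)) =
        1 / (i + 1 : ℝ) ^ (q + 2) * ∑ k ∈ Finset.range (i + 1), 1 / (k + 1 : ℝ) := by
      rw [Finset.mul_sum]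
      exact Finset.sum_congr rfl fun k _ => by field_simp
    rw [h', ← h.tsum_eq, ENNReal.ofReal_tsum_of_nonneg (fun _ => by positivity) h.summable]
    refine tsum_congr fun j => ?_
    congr 1
    field_simp
    ring
  -- The function is supported on `i ≤ j`, so only the strict upper triangle and the diagonal
  -- survive.
  have h2 := ENNReal.tsum_tsum_eq_lt_add_eq_add_gt
    (fun i j => if i ≤ j then ENNReal.ofReal (1 / ((i + 1) * (j + 1 : ℝ) ^ (q + 2))) else 0)
  rw [ENNReal.tsum_comm] at h2
  rw [tornheimSum]
  simp_rw [h1]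
  calc _ = ∑' (j : ℕ) (i : ℕ),
        if i ≤ j then ENNReal.ofReal (1 / ((i + 1) * (j + 1 : ℝ) ^ (q + 2))) else 0 := by
        refine tsum_congr fun j => ?_
        rw [tsum_eq_sum (s := Finset.range (j + 1))]
        · refine Finset.sum_congr rfl fun i hi => ?_
          rw [if_pos (by simpa [Nat.lt_succ_iff] using hi)]
        · intro i hi
          rw [if_neg (by simpa [Nat.lt_succ_iff] using hi)]
    _ = _ := by
        rw [h2]
        have h3 : ∀ j k : ℕ, ¬ (j + k + 1 ≤ j) := fun j k => by omega
        have h4 : ∀ j k : ℕ, (j ≤ j + k + 1) := fun j k => by omega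
        simp only [h3, h4, if_true, if_false, tsum_zero, add_zero, le_refl]
        unfold tornheimSum dirichletSum
        congr 1
        · refine tsum_congr fun i => tsum_congr fun j => ?_
          push_cast
          congr 2
          ring
        · refine tsum_congr fun i => ?_
          congr 2
          ring

theorem dirichletSum_ne_top {s : ℕ} (hs : 2 ≤ s) : dirichletSum s ≠ ∞ := by
  have h : Summable fun i : ℕ => 1 / (i + 1 : ℝ) ^ s := by
    have := (summable_nat_add_iff 1).2 (Real.summable_one_div_nat_pow.2 (show 1 < s by omega))
    simpa using this
  exact h.tsum_ofReal_ne_top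

/-- Since √(mn) ≤ m + n, the terms are dominated by (mn)^(-3/2), which is a product of convergent
series. Finiteness is what later permits cancellation and passage to real numbers. -/
theorem tornheimSum_one_one_ne_top (n : ℕ) : tornheimSum 1 1 (n + 1) ≠ ∞ := by
  have h : Summable fun i : ℕ => 1 / (i + 1 : ℝ) ^ (3 / 2 : ℝ) := by
    have := (summable_nat_add_iff 1).2
      (Real.summable_one_div_nat_rpow.2 (show (1 : ℝ) < 3 / 2 by norm_num))
    simpa using this
  have h' := h.tsum_ofReal_ne_top
  refine ne_top_of_le_ne_top (ENNReal.mul_ne_top h' h') ?_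
  rw [← ENNReal.tsum_mul_right]
  refine ENNReal.tsum_le_tsum fun i => ?_
  rw [← ENNReal.tsum_mul_left]
  refine ENNReal.tsum_le_tsum fun j => ?_
  rw [← ENNReal.ofReal_mul (by positivity)]
  refine ENNReal.ofReal_le_ofReal ?_
  rw [one_div_mul_one_div]
  refine one_div_le_one_div_of_le (by positivity) ?_
  have e : ∀ x : ℝ, 0 < x → x ^ (3 / 2 : ℝ) = x * √x := by
    intro x hx
    rw [Real.sqrt_eq_rpow, ← Real.rpow_one_add' hx.le (by norm_num)]
    norm_num
  rw [e _ (by positivity), e _ (by positivity)]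
  have h1 : √(i + 1 : ℝ) * √(j + 1 : ℝ) ≤ i + j + 2 := by
    nlinarith [sq_nonneg (√(i + 1 : ℝ) - √(j + 1 : ℝ)), Real.sq_sqrt (show (0 : ℝ) ≤ i + 1 by positivity),
      Real.sq_sqrt (show (0 : ℝ) ≤ j + 1 by positivity)]
  have h2 : (i + j + 2 : ℝ) ≤ (i + j + 2) ^ (n + 1) := le_self_pow₀ (by linarith [i.cast_nonneg (α := ℝ), j.cast_nonneg (α := ℝ)]) (by omega)
  calc _ = ((i + 1) * (j + 1)) * (√(i + 1 : ℝ) * √(j + 1 : ℝ)) := by ring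
    _ ≤ ((i + 1) * (j + 1)) * (i + j + 2) ^ (n + 1) :=
      mul_le_mul_of_nonneg_left (h1.trans h2) (by positivity)
    _ = _ := by ring

theorem tornheimSum_one_one (n : ℕ) :
    tornheimSum 1 1 n = tornheimSum 1 0 (n + 1) + tornheimSum 1 0 (n + 1) := by
  rw [tornheimSum_succ_succ, tornheimSum_comm 0]

theorem tornheimSum_one_zero_ne_top (n : ℕ) : tornheimSum 1 0 (n + 2) ≠ ∞ := by
  have h := tornheimSum_one_one_ne_top n
  rw [tornheimSum_one_one] at h
  exact (ENNReal.add_ne_top.1 h).1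

theorem tornheimSum_zero_ne_top {a b : ℕ} (ha : 2 ≤ a) (hb : 2 ≤ b) : tornheimSum a 0 b ≠ ∞ := by
  have h := ENNReal.mul_ne_top (dirichletSum_ne_top ha) (dirichletSum_ne_top hb)
  rw [dirichletSum_mul, ENNReal.add_ne_top, ENNReal.add_ne_top] at h
  exact h.1.1

theorem riemannZeta_eq_dirichletSum {s : ℕ} (hs : 2 ≤ s) :
    riemannZeta s = ((dirichletSum s).toReal : ℂ) := by
  have h := zeta_eq_tsum_one_div_nat_add_one_cpow (s := s) (by simpa using (show 1 < s by omega))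
  rw [h, dirichletSum, ENNReal.tsum_toReal_eq (fun _ => ENNReal.ofReal_ne_top), Complex.ofReal_tsum]
  refine tsum_congr fun i => ?_
  rw [ENNReal.toReal_ofReal (by positivity)]
  push_cast
  rw [Complex.cpow_natCast]

theorem dirichletSum_mul_toReal {a b : ℕ} (ha : 2 ≤ a) (hb : 2 ≤ b) :
    (dirichletSum a).toReal * (dirichletSum b).toReal =
      (tornheimSum a 0 b).toReal + (tornheimSum b 0 a).toReal + (dirichletSum (a + b)).toReal := by
  rw [← ENNReal.toReal_mul, dirichletSum_mul,
    ENNReal.toReal_add (ENNReal.add_ne_top.2 ⟨tornheimSum_zero_ne_top ha hb,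
      tornheimSum_zero_ne_top hb ha⟩) (dirichletSum_ne_top (by omega)),
    ENNReal.toReal_add (tornheimSum_zero_ne_top ha hb) (tornheimSum_zero_ne_top hb ha)]

theorem tornheimSum_one_zero_two : (tornheimSum 1 0 2).toReal = (dirichletSum 3).toReal := by
  have h := tornheimSum_succ_one_one 0
  rw [tornheimSum_one_one, ENNReal.add_right_inj (tornheimSum_one_zero_ne_top 0)] at h
  rw [h]

/-- Repeated partial fractions on the left of `tornheimSum_succ_one_one` give ζ(3,1) + ζ(2,2) = ζ(4)
after cancellation. The stuffle square of ζ(2) then eliminates ζ(2,2). The next two evaluations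
follow the same scheme in weights 5 and 6. -/
theorem tornheimSum_one_zero_three :
    2 * (tornheimSum 1 0 3).toReal =
      3 * (dirichletSum 4).toReal - (dirichletSum 2).toReal ^ 2 := by
  have h := tornheimSum_succ_one_one 1
  have h0 := tornheimSum_one_zero_ne_top 1
  have h1 := tornheimSum_zero_ne_top (le_refl 2) (le_refl 2)
  rw [tornheimSum_succ_succ, tornheimSum_one_one] at h
  have h2 := congrArg ENNReal.toReal h
  rw [ENNReal.toReal_add (by simp [h0]) h1, ENNReal.toReal_add h0 h0,
    ENNReal.toReal_add h0 (dirichletSum_ne_top (by norm_num))] at h2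
  have h3 := dirichletSum_mul_toReal (le_refl 2) (le_refl 2)
  norm_num at h2 h3 ⊢
  linarith

theorem tornheimSum_one_zero_four :
    (tornheimSum 1 0 4).toReal =
      2 * (dirichletSum 5).toReal - (dirichletSum 2).toReal * (dirichletSum 3).toReal := by
  have h := tornheimSum_succ_one_one 2
  have h0 := tornheimSum_one_zero_ne_top 2
  have h1 := tornheimSum_zero_ne_top (le_refl 2) (show 2 ≤ 3 by norm_num)
  have h1' := tornheimSum_zero_ne_top (show 2 ≤ 3 by norm_num) (le_refl 2)
  rw [tornheimSum_succ_succ, tornheimSum_succ_succ, tornheimSum_one_one] at h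
  have h2 := congrArg ENNReal.toReal h
  rw [ENNReal.toReal_add (by simp [h0, h1]) h1', ENNReal.toReal_add (by simp [h0]) h1,
    ENNReal.toReal_add h0 h0, ENNReal.toReal_add h0 (dirichletSum_ne_top (by norm_num))] at h2
  have h3 := dirichletSum_mul_toReal (le_refl 2) (show 2 ≤ 3 by norm_num)
  norm_num at h2 h3 ⊢
  linarith

theorem tornheimSum_one_zero_five :
    2 * (tornheimSum 1 0 5).toReal =
      5 * (dirichletSum 6).toReal - 2 * (dirichletSum 2).toReal * (dirichletSum 4).toReal
        - (dirichletSum 3).toReal ^ 2 := by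
  have h := tornheimSum_succ_one_one 3
  have h0 := tornheimSum_one_zero_ne_top 3
  have h1 := tornheimSum_zero_ne_top (le_refl 2) (show 2 ≤ 4 by norm_num)
  have h1' := tornheimSum_zero_ne_top (show 2 ≤ 3 by norm_num) (show 2 ≤ 3 by norm_num)
  have h1'' := tornheimSum_zero_ne_top (show 2 ≤ 4 by norm_num) (le_refl 2)
  rw [tornheimSum_succ_succ, tornheimSum_succ_succ, tornheimSum_succ_succ, tornheimSum_one_one] at h
  have h2 := congrArg ENNReal.toReal h
  rw [ENNReal.toReal_add (by simp [h0, h1, h1']) h1'', ENNReal.toReal_add (by simp [h0, h1]) h1',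
    ENNReal.toReal_add (by simp [h0]) h1,
    ENNReal.toReal_add h0 h0, ENNReal.toReal_add h0 (dirichletSum_ne_top (by norm_num))] at h2
  have h3 := dirichletSum_mul_toReal (le_refl 2) (show 2 ≤ 4 by norm_num)
  have h4 := dirichletSum_mul_toReal (show 2 ≤ 3 by norm_num) (show 2 ≤ 3 by norm_num)
  norm_num at h2 h3 h4 ⊢
  linarith

theorem riemannZeta_six : riemannZeta 6 = (Real.pi : ℂ) ^ 6 / 945 := by
  have h := riemannZeta_two_mul_nat (k := 3) (by norm_num)
  have h6 : bernoulli 6 = 1 / 42 := by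
    rw [bernoulli_eq_bernoulli'_of_ne_one (by norm_num), bernoulli'_def]
    have h5 : bernoulli' 5 = 0 := bernoulli'_eq_zero_of_odd (by decide) (by norm_num)
    norm_num [Finset.sum_range_succ, h5, Nat.choose]
  norm_num [h6, Nat.factorial] at h
  rw [h]
  ring

theorem riemannZeta_two_sq : riemannZeta 2 ^ 2 = 5 / 2 * riemannZeta 4 := by
  rw [riemannZeta_two, riemannZeta_four]
  ring

theorem riemannZeta_two_mul_four : riemannZeta 2 * riemannZeta 4 = 7 / 4 * riemannZeta 6 := by
  rw [riemannZeta_two, riemannZeta_four, riemannZeta_six]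
  ring

end DoubleSums

/-! ### Integrability and integration by parts against powers of the logarithm on (0,1]. -/

section LogMoments

open MeasureTheory Set Filter Topology

theorem Real.abs_log_pow_le_rpow (m : ℕ) {t : ℝ} (h0 : 0 < t) (h1 : t ≤ 1) :
    |Real.log t| ^ m ≤ (2 * (m + 1) : ℝ) ^ m * t ^ (-(1 / 2) : ℝ) := by
  -- The exponent 1/(2(m+1)) is chosen so that, after raising to the power `m`, the singularity is
  -- still no worse than `t ^ (-1/2)`.
  have hb := Real.abs_log_mul_self_rpow_lt t (1 / (2 * (m + 1))) h0 h1 (by positivity)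
  rw [one_div_one_div, abs_mul, abs_of_pos (Real.rpow_pos_of_pos h0 _)] at hb
  have h2 : |Real.log t| ≤ 2 * (m + 1) * t ^ (-(1 / (2 * (m + 1))) : ℝ) := by
    rw [Real.rpow_neg h0.le, ← div_eq_mul_inv, le_div_iff₀ (Real.rpow_pos_of_pos h0 _)]
    exact hb.le
  calc |Real.log t| ^ m ≤ (2 * (m + 1) * t ^ (-(1 / (2 * (m + 1))) : ℝ)) ^ m :=
        pow_le_pow_left₀ (abs_nonneg _) h2 m
    _ = (2 * (m + 1) : ℝ) ^ m * t ^ (-(1 / (2 * (m + 1))) * m : ℝ) := by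
        rw [mul_pow, Real.rpow_mul_natCast h0.le]
    _ ≤ _ := by
        refine mul_le_mul_of_nonneg_left (Real.rpow_le_rpow_of_exponent_ge h0 h1 ?_) (by positivity)
        rw [neg_mul, neg_le_neg_iff, one_div_mul_eq_div, div_le_div_iff₀ (by positivity) two_pos]
        linarith

theorem intervalIntegrable_abs_log_pow (m : ℕ) :
    IntervalIntegrable (fun t : ℝ => |Real.log t| ^ m) volume 0 1 := by
  refine ((intervalIntegral.intervalIntegrable_rpow' (a := 0) (b := 1)
    (show (-1 : ℝ) < -(1 / 2) by norm_num)).const_mul ((2 * (m + 1) : ℝ) ^ m)).mono_fun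
    ((Real.measurable_log.norm.pow_const m).aestronglyMeasurable) ?_
  refine (ae_restrict_iff' measurableSet_uIoc).2 (Eventually.of_forall fun t ht => ?_)
  rw [uIoc_of_le zero_le_one] at ht
  simp only [norm_pow, Real.norm_eq_abs, abs_abs]
  exact (Real.abs_log_pow_le_rpow m ht.1 ht.2).trans (le_abs_self _)

theorem intervalIntegrable_log_pow_mul {g : ℝ → ℂ} {C : ℝ} (m : ℕ)
    (hg : ContinuousOn g (Ioc 0 1)) (hC : ∀ t ∈ Ioc (0 : ℝ) 1, ‖g t‖ ≤ C) :
    IntervalIntegrable (fun t : ℝ => (Real.log t : ℂ) ^ m * g t) volume 0 1 := by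
  refine ((intervalIntegrable_abs_log_pow m).const_mul C).mono_fun ?_ ?_
  · rw [uIoc_of_le zero_le_one]
    refine ContinuousOn.aestronglyMeasurable ?_ measurableSet_Ioc
    refine ContinuousOn.mul (ContinuousOn.pow ?_ m) hg
    exact Complex.continuous_ofReal.comp_continuousOn
      (Real.continuousOn_log.mono fun t ht => ht.1.ne')
  · refine (ae_restrict_iff' measurableSet_uIoc).2 (Eventually.of_forall fun t ht => ?_)
    rw [uIoc_of_le zero_le_one] at ht
    simp only [norm_mul, norm_pow, Complex.norm_real, Real.norm_eq_abs, abs_abs]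
    rw [mul_comm]
    exact mul_le_mul_of_nonneg_right ((hC t ht).trans (le_abs_self C)) (by positivity)

variable {φ φ' : ℝ → ℂ}

theorem exists_norm_le_mul_of_hasDerivAt (hφ : ∀ t ∈ Icc (0 : ℝ) 1, HasDerivAt φ (φ' t) t)
    (hφ' : ContinuousOn φ' (Icc 0 1)) (h0 : φ 0 = 0) :
    ∃ M, ∀ t ∈ Icc (0 : ℝ) 1, ‖φ t‖ ≤ M * t := by
  obtain ⟨M, hM⟩ := isCompact_Icc.exists_bound_of_continuousOn hφ'
  refine ⟨M, fun t ht => ?_⟩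
  have := (convex_Icc (0 : ℝ) 1).norm_image_sub_le_of_norm_hasDerivWithin_le
    (fun x hx => (hφ x hx).hasDerivWithinAt) hM (left_mem_Icc.2 zero_le_one) ht
  simpa [h0, abs_of_nonneg ht.1] using this

theorem intervalIntegrable_log_pow_mul_div (m : ℕ)
    (hφ : ∀ t ∈ Icc (0 : ℝ) 1, HasDerivAt φ (φ' t) t)
    (hφ' : ContinuousOn φ' (Icc 0 1)) (h0 : φ 0 = 0) :
    IntervalIntegrable (fun t : ℝ => (Real.log t : ℂ) ^ m * φ t / t) volume 0 1 := by
  obtain ⟨M, hM⟩ := exists_norm_le_mul_of_hasDerivAt hφ hφ' h0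
  simp_rw [mul_div_assoc]
  refine intervalIntegrable_log_pow_mul (C := M) m ?_ ?_
  · refine ContinuousOn.div (fun t ht => (hφ t (Ioc_subset_Icc_self ht)).continuousAt.continuousWithinAt)
      Complex.continuous_ofReal.continuousOn fun t ht => ?_
    exact_mod_cast ht.1.ne'
  · intro t ht
    rw [norm_div, Complex.norm_real, Real.norm_of_nonneg ht.1.le, div_le_iff₀ ht.1]
    exact hM t (Ioc_subset_Icc_self ht)

/-- Integration by parts against a power of the logarithm. -/
theorem integral_log_pow_succ_mul_deriv (m : ℕ)
    (hφ : ∀ t ∈ Icc (0 : ℝ) 1, HasDerivAt φ (φ' t) t)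
    (hφ' : ContinuousOn φ' (Icc 0 1)) (h0 : φ 0 = 0) :
    ∫ t in (0 : ℝ)..1, (Real.log t : ℂ) ^ (m + 1) * φ' t =
      -((m + 1 : ℂ) * ∫ t in (0 : ℝ)..1, (Real.log t : ℂ) ^ m * φ t / t) := by
  obtain ⟨M, hM⟩ := exists_norm_le_mul_of_hasDerivAt hφ hφ' h0
  obtain ⟨C, hC⟩ := isCompact_Icc.exists_bound_of_continuousOn hφ'
  have hi1 : IntervalIntegrable (fun t : ℝ => (Real.log t : ℂ) ^ (m + 1) * φ' t) volume 0 1 :=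
    intervalIntegrable_log_pow_mul (C := C) (m + 1) (hφ'.mono Ioc_subset_Icc_self)
      fun t ht => hC t (Ioc_subset_Icc_self ht)
  have hi2 := intervalIntegrable_log_pow_mul_div m hφ hφ' h0
  have hd : ∀ t ∈ Ioo (0 : ℝ) 1, HasDerivAt (fun t : ℝ => (Real.log t : ℂ) ^ (m + 1) * φ t)
      ((m + 1 : ℂ) * ((Real.log t : ℂ) ^ m * φ t / t) + (Real.log t : ℂ) ^ (m + 1) * φ' t) t := by
    intro t ht
    have h1 := ((Real.hasDerivAt_log ht.1.ne').ofReal_comp.pow (m + 1)).mul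
      (hφ t (Ioo_subset_Icc_self ht))
    convert! h1 using 1
    simp only [Pi.pow_apply, Nat.add_sub_cancel]
    push_cast
    ring
  have hc : ContinuousOn (fun t : ℝ => (Real.log t : ℂ) ^ (m + 1) * φ t) (Icc 0 1) := by
    intro t ht
    rcases ht.1.eq_or_lt with rfl | h
    -- At 0 the product is squeezed by a multiple of `t ^ (1/2)`: the logarithmic power is
    -- O(t^(-1/2)) and `φ` is O(t).
    · have hlim : Tendsto (fun t : ℝ => M * ((2 * ((m + 1 : ℕ) + 1) : ℝ) ^ (m + 1) * t ^ (1 / 2 : ℝ)))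
          (𝓝[Icc 0 1] 0) (𝓝 0) := by
        have : Tendsto (fun t : ℝ => M * ((2 * ((m + 1 : ℕ) + 1) : ℝ) ^ (m + 1) * t ^ (1 / 2 : ℝ)))
          (𝓝 0) (𝓝 (M * ((2 * ((m + 1 : ℕ) + 1) : ℝ) ^ (m + 1) * 0 ^ (1 / 2 : ℝ)))) :=
          ((((Real.continuous_rpow_const (by norm_num)).tendsto 0).const_mul _).const_mul _)
        rw [Real.zero_rpow (by norm_num), mul_zero, mul_zero] at this
        exact this.mono_left nhdsWithin_le_nhds
      refine ContinuousWithinAt.congr_of_eventuallyEq (f := fun t : ℝ => (Real.log t : ℂ) ^ (m + 1) * φ t)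
        ?_ (EventuallyEq.refl _ _) rfl
      unfold ContinuousWithinAt
      simp only [h0, mul_zero]
      refine squeeze_zero_norm' ?_ hlim
      filter_upwards [self_mem_nhdsWithin] with s hs
      rcases hs.1.eq_or_lt with rfl | h
      · simp [h0]
      · rw [norm_mul, norm_pow, Complex.norm_real, Real.norm_eq_abs]
        have e : s ^ (1 / 2 : ℝ) = s ^ (-(1 / 2) : ℝ) * s := by
          rw [← Real.rpow_add_one h.ne']
          norm_num
        calc _ ≤ (2 * ((m + 1 : ℕ) + 1) : ℝ) ^ (m + 1) * s ^ (-(1 / 2) : ℝ) * (M * s) :=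
              mul_le_mul (Real.abs_log_pow_le_rpow (m + 1) h hs.2) (hM s hs) (norm_nonneg _)
                (by positivity)
          _ = _ := by
              rw [e]
              ring
    · refine ContinuousAt.continuousWithinAt (ContinuousAt.mul (ContinuousAt.pow ?_ _)
        (hφ t ht).continuousAt)
      exact Complex.continuous_ofReal.continuousAt.comp (Real.continuousAt_log h.ne')
  have h := intervalIntegral.integral_eq_sub_of_hasDerivAt_of_le zero_le_one hc hd
    ((hi2.const_mul _).add hi1)
  rw [intervalIntegral.integral_add (hi2.const_mul _) hi1, intervalIntegral.integral_const_mul] at h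
  -- Both boundary terms vanish: at 1 because log 1 = 0 occurs to the positive power `m + 1`, at 0
  -- because `φ 0 = 0`.
  simp [h0] at h
  linear_combination h

end LogMoments

/-! ### Logarithmic moments as holomorphic functions of the parameter `z`. -/

section ParametricLogMoments

open MeasureTheory Set Filter Topology

/-- The plane cut along `[1, ∞)`. -/
def rayCutPlane : Set ℂ := {z | 1 - z ∈ Complex.slitPlane}

theorem isOpen_rayCutPlane : IsOpen rayCutPlane :=
  Complex.isOpen_slitPlane.preimage (by fun_prop)

/-- The plane cut along [1, ∞) is star-shaped about 0, because the slit plane is star-shaped about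
1; hence all integration segments stay in the domain. -/
theorem mul_mem_rayCutPlane {z : ℂ} (hz : z ∈ rayCutPlane) {t : ℝ} (ht : t ∈ Icc (0 : ℝ) 1) :
    z * t ∈ rayCutPlane := by
  have h := Complex.starConvex_one_slitPlane hz (show 0 ≤ 1 - t by linarith [ht.2]) ht.1 (by ring)
  have e : 1 - z * t = (1 - t) • (1 : ℂ) + t • (1 - z) := by
    simp only [Complex.real_smul]
    push_cast
    ring
  change 1 - z * t ∈ Complex.slitPlane
  rw [e]
  exact h

variable {f : ℂ → ℂ}

theorem hasDerivAt_comp_mul_ofReal (hf : DifferentiableOn ℂ f rayCutPlane) {z : ℂ}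
    (hz : z ∈ rayCutPlane) {t : ℝ} (ht : t ∈ Icc (0 : ℝ) 1) :
    HasDerivAt (fun t : ℝ => f (z * t)) (z * deriv f (z * t)) t := by
  have h1 := (hf.differentiableAt (isOpen_rayCutPlane.mem_nhds (mul_mem_rayCutPlane hz ht))).hasDerivAt
  have h2 : HasDerivAt (fun t : ℝ => z * (t : ℂ)) z t := by
    simpa using (Complex.ofRealCLM.hasDerivAt (x := t)).const_mul z
  simpa [mul_comm, Function.comp_def] using h1.comp t h2

theorem continuousOn_deriv_comp_mul_ofReal (hf : DifferentiableOn ℂ f rayCutPlane) {z : ℂ}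
    (hz : z ∈ rayCutPlane) : ContinuousOn (fun t : ℝ => deriv f (z * t)) (Icc 0 1) :=
  (hf.deriv isOpen_rayCutPlane).continuousOn.comp (by fun_prop) fun _ ht => mul_mem_rayCutPlane hz ht

/-- Differentiation of a logarithmic moment of `f (z t) / t` with respect to `z`. -/
theorem hasDerivAt_integral_log_pow_mul_div (m : ℕ) (hf : DifferentiableOn ℂ f rayCutPlane)
    (h0 : f 0 = 0) {z : ℂ} (hz : z ∈ rayCutPlane) :
    HasDerivAt (fun z : ℂ => ∫ t in (0 : ℝ)..1, (Real.log t : ℂ) ^ m * f (z * t) / t)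
      (∫ t in (0 : ℝ)..1, (Real.log t : ℂ) ^ m * deriv f (z * t)) z := by
  obtain ⟨r, hr, hball⟩ := Metric.nhds_basis_closedBall.mem_iff.1 (isOpen_rayCutPlane.mem_nhds hz)
  -- The points `w * t` with `w` near `z` fill a compact subset of the domain, giving a uniform
  -- bound on `deriv f`. Differentiating `f (w * t) / t` in `w` cancels the factor `1 / t`, so `C *
  -- |log t| ^ m` dominates.
  have hK : IsCompact ((fun p : ℝ × ℂ => p.2 * (p.1 : ℂ)) '' (Icc 0 1 ×ˢ Metric.closedBall z r)) :=
    (isCompact_Icc.prod (isCompact_closedBall z r)).image (by fun_prop)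
  have hsub : (fun p : ℝ × ℂ => p.2 * (p.1 : ℂ)) '' (Icc 0 1 ×ˢ Metric.closedBall z r) ⊆ rayCutPlane := by
    rintro _ ⟨p, hp, rfl⟩
    exact mul_mem_rayCutPlane (hball hp.2) hp.1
  obtain ⟨C, hC⟩ := hK.exists_bound_of_continuousOn
    ((hf.deriv isOpen_rayCutPlane).continuousOn.mono hsub)
  have hint : ∀ w ∈ rayCutPlane,
      IntervalIntegrable (fun t : ℝ => (Real.log t : ℂ) ^ m * f (w * t) / t) volume 0 1 :=
    fun w hw => intervalIntegrable_log_pow_mul_div m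
      (fun t ht => hasDerivAt_comp_mul_ofReal hf hw ht)
      (continuousOn_const.mul (continuousOn_deriv_comp_mul_ofReal hf hw)) (by simp [h0])
  have hC' : ∀ t ∈ Ioc (0 : ℝ) 1, ∀ w ∈ Metric.closedBall z r, ‖deriv f (w * t)‖ ≤ C :=
    fun t ht w hw => hC _ ⟨(t, w), ⟨Ioc_subset_Icc_self ht, hw⟩, rfl⟩
  refine (intervalIntegral.hasDerivAt_integral_of_dominated_loc_of_deriv_le
    (F' := fun w t => (Real.log t : ℂ) ^ m * deriv f (w * t))
    (bound := fun t => C * |Real.log t| ^ m)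
    (Metric.closedBall_mem_nhds z hr) ?_ (hint z hz) ?_ ?_
    ((intervalIntegrable_abs_log_pow m).const_mul C) ?_).2
  · filter_upwards [isOpen_rayCutPlane.mem_nhds hz] with w hw
    exact (hint w hw).def'.aestronglyMeasurable
  · exact (intervalIntegrable_log_pow_mul (C := C) m
      ((continuousOn_deriv_comp_mul_ofReal hf hz).mono Ioc_subset_Icc_self)
      fun t ht => hC' t ht z (Metric.mem_closedBall_self hr.le)).def'.aestronglyMeasurable
  · refine Eventually.of_forall fun t ht w hw => ?_
    rw [uIoc_of_le zero_le_one] at ht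
    rw [norm_mul, norm_pow, Complex.norm_real, Real.norm_eq_abs, mul_comm]
    exact mul_le_mul_of_nonneg_right (hC' t ht w hw) (by positivity)
  · refine Eventually.of_forall fun t ht w hw => ?_
    rw [uIoc_of_le zero_le_one] at ht
    have ht0 : (t : ℂ) ≠ 0 := by exact_mod_cast ht.1.ne'
    have h1 := (hf.differentiableAt (isOpen_rayCutPlane.mem_nhds
      (mul_mem_rayCutPlane (hball hw) (Ioc_subset_Icc_self ht)))).hasDerivAt
    have h2 := ((h1.comp w ((hasDerivAt_id w).mul_const (t : ℂ))).const_mul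
      ((Real.log t : ℂ) ^ m)).div_const (t : ℂ)
    convert! h2 using 1
    field_simp

/-- Integration by parts turns `z d/dz` of one moment into the moment of next lower logarithmic
order; this is the source of the recursion in the first index of `nielsenS`. -/
theorem mul_integral_log_pow_succ_mul_deriv (m : ℕ) (hf : DifferentiableOn ℂ f rayCutPlane)
    (h0 : f 0 = 0) {z : ℂ} (hz : z ∈ rayCutPlane) :
    z * ∫ t in (0 : ℝ)..1, (Real.log t : ℂ) ^ (m + 1) * deriv f (z * t) =
      -((m + 1 : ℂ) * ∫ t in (0 : ℝ)..1, (Real.log t : ℂ) ^ m * f (z * t) / t) := by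
  rw [← integral_log_pow_succ_mul_deriv m (fun t ht => hasDerivAt_comp_mul_ofReal hf hz ht)
      (continuousOn_const.mul (continuousOn_deriv_comp_mul_ofReal hf hz)) (by simp [h0]),
    ← intervalIntegral.integral_const_mul]
  congr 1
  funext t
  ring

theorem mul_integral_deriv_comp_mul (hf : DifferentiableOn ℂ f rayCutPlane)
    (h0 : f 0 = 0) {z : ℂ} (hz : z ∈ rayCutPlane) :
    z * ∫ t in (0 : ℝ)..1, deriv f (z * t) = f z := by
  rw [← intervalIntegral.integral_const_mul, intervalIntegral.integral_eq_sub_of_hasDerivAt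
    (f := fun t : ℝ => f (z * t))]
  · simp [h0]
  · intro t ht
    rw [uIcc_of_le zero_le_one] at ht
    exact hasDerivAt_comp_mul_ofReal hf hz ht
  · refine ContinuousOn.intervalIntegrable ?_
    rw [uIcc_of_le zero_le_one]
    exact continuousOn_const.mul (continuousOn_deriv_comp_mul_ofReal hf hz)

end ParametricLogMoments

/-! ### Differential equations of the Nielsen polylogarithms, and classical polylogarithms as the
case p = 1. -/

section Nielsen

open MeasureTheory Set Filter Topology

theorem hasDerivAt_log_one_sub {z : ℂ} (hz : z ∈ rayCutPlane) :
    HasDerivAt (fun z : ℂ => Complex.log (1 - z)) (-(1 / (1 - z))) z := by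
  have h := (((hasDerivAt_id z).const_sub 1).clog hz)
  simpa [neg_div] using h

theorem differentiableOn_log_one_sub_pow (p : ℕ) :
    DifferentiableOn ℂ (fun z : ℂ => Complex.log (1 - z) ^ p) rayCutPlane :=
  fun _ hz => ((hasDerivAt_log_one_sub hz).differentiableAt.pow p).differentiableWithinAt

theorem nielsenS_zero (n p : ℕ) : nielsenS n (p + 1) 0 = 0 := by
  simp [nielsenS]

theorem differentiableAt_nielsenS (n p : ℕ) {z : ℂ} (hz : z ∈ rayCutPlane) :
    DifferentiableAt ℂ (nielsenS n (p + 1)) z :=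
  ((hasDerivAt_integral_log_pow_mul_div (n - 1) (differentiableOn_log_one_sub_pow (p + 1))
    (by simp) hz).const_mul _).differentiableAt

theorem hasDerivAt_nielsenS_succ (n p : ℕ) {z : ℂ} (hz : z ∈ rayCutPlane) (hz0 : z ≠ 0) :
    HasDerivAt (nielsenS (n + 2) (p + 1)) (nielsenS (n + 1) (p + 1) z / z) z := by
  have hf := differentiableOn_log_one_sub_pow (p + 1)
  refine ((hasDerivAt_integral_log_pow_mul_div (n + 1) hf (by simp) hz).const_mul _).congr_deriv ?_
  have h := mul_integral_log_pow_succ_mul_deriv n hf (by simp) hz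
  rw [eq_div_iff hz0, mul_assoc, mul_comm _ z, h]
  simp only [nielsenS, Nat.add_sub_cancel, show n + 2 - 1 = n + 1 from rfl, Nat.factorial_succ n,
    show n + 2 + (p + 1) - 1 = (n + 1 + (p + 1) - 1) + 1 by omega, pow_succ (-1 : ℂ)]
  have h1 : ((n.factorial : ℕ) : ℂ) ≠ 0 := by exact_mod_cast n.factorial_ne_zero
  have h2 : (((p + 1).factorial : ℕ) : ℂ) ≠ 0 := by exact_mod_cast (p + 1).factorial_ne_zero
  have h3 : (n + 1 : ℂ) ≠ 0 := by exact_mod_cast n.succ_ne_zero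
  push_cast
  field_simp

theorem hasDerivAt_nielsenS_one (p : ℕ) {z : ℂ} (hz : z ∈ rayCutPlane) (hz0 : z ≠ 0) :
    HasDerivAt (nielsenS 1 (p + 1))
      ((-1) ^ (p + 1) / (p + 1).factorial * Complex.log (1 - z) ^ (p + 1) / z) z := by
  have hf := differentiableOn_log_one_sub_pow (p + 1)
  refine ((hasDerivAt_integral_log_pow_mul_div 0 hf (by simp) hz).const_mul _).congr_deriv ?_
  have h := mul_integral_deriv_comp_mul hf (by simp) hz
  simp only [pow_zero, one_mul]
  rw [eq_div_iff hz0, mul_assoc, mul_comm _ z, h]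
  simp

/-- Along the segment from 0 to `z`, the integrand defining the next `Li` is the derivative of the
next `S_{·,1}`, which vanishes at 0. This lets all later arguments work with `nielsenS` alone. -/
theorem classicalLi_eq_nielsenS (n : ℕ) {z : ℂ} (hz : z ∈ rayCutPlane) :
    classicalLi (n + 2) z = nielsenS (n + 1) 1 z := by
  induction n generalizing z with
  | zero =>
    simp only [classicalLi, nielsenS]
    rw [← intervalIntegral.integral_const_mul]
    congr 1
    funext t
    simp [mul_comm, neg_div]
  | succ n ih =>
    rcases eq_or_ne z 0 with rfl | hz0
    · rw [nielsenS_zero]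
      have h0 : classicalLi (n + 2) 0 = 0 := by
        rw [ih (by simp [rayCutPlane]), nielsenS_zero]
      rw [classicalLi]
      simp [h0]
    rw [classicalLi]
    have hd : DifferentiableOn ℂ (nielsenS (n + 1) 1) rayCutPlane := fun w hw =>
      (differentiableAt_nielsenS (n + 1) 0 hw).differentiableWithinAt
    have hd' : DifferentiableOn ℂ (nielsenS (n + 2) 1) rayCutPlane := fun w hw =>
      (differentiableAt_nielsenS (n + 2) 0 hw).differentiableWithinAt
    have hint := intervalIntegrable_log_pow_mul_div 0
      (fun t ht => hasDerivAt_comp_mul_ofReal hd hz ht)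
      (continuousOn_const.mul (continuousOn_deriv_comp_mul_ofReal hd hz))
      (by simp [nielsenS_zero (n + 1) 0])
    simp only [pow_zero, one_mul] at hint
    have h := intervalIntegral.integral_eq_sub_of_hasDerivAt_of_le (zero_le_one' ℝ)
      (fun t ht => (hasDerivAt_comp_mul_ofReal hd' hz ht).continuousAt.continuousWithinAt) ?_ hint
    · simp only [Complex.ofReal_one, mul_one, Complex.ofReal_zero, mul_zero, nielsenS_zero _ 0,
        sub_zero] at h
      rw [← h]
      refine intervalIntegral.integral_congr fun t ht => ?_
      rw [uIcc_of_le zero_le_one] at ht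
      simp only [mul_comm (t : ℂ) z]
      rw [ih (mul_mem_rayCutPlane hz ht)]
    · intro t ht
      have ht0 : (t : ℂ) ≠ 0 := by exact_mod_cast ht.1.ne'
      have hm := mul_mem_rayCutPlane hz (Ioo_subset_Icc_self ht)
      have h1 := hasDerivAt_comp_mul_ofReal hd' hz (Ioo_subset_Icc_self ht)
      rw [(hasDerivAt_nielsenS_succ n 0 hm (mul_ne_zero hz0 ht0)).deriv] at h1
      convert! h1 using 1
      field_simp

end Nielsen

/-! ### Values and limits of `S_{n,1}` and `S_{n,2}` at the branch point 1. -/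

section ValuesAtOne

open MeasureTheory Set Filter Topology
open scoped ENNReal

theorem integral_log_pow_mul_pow (k m : ℕ) :
    ∫ t in (0 : ℝ)..1, (Real.log t : ℂ) ^ k * (t : ℂ) ^ m =
      (-1) ^ k * k.factorial / (m + 1 : ℂ) ^ (k + 1) := by
  have hm : (m + 1 : ℂ) ≠ 0 := by exact_mod_cast m.succ_ne_zero
  have hd : ∀ t ∈ Icc (0 : ℝ) 1,
      HasDerivAt (fun t : ℝ => (t : ℂ) ^ (m + 1)) ((m + 1 : ℂ) * (t : ℂ) ^ m) t := by
    intro t _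
    have := (hasDerivAt_pow (m + 1) (t : ℂ)).comp_ofReal
    simpa using this
  have hc : ContinuousOn (fun t : ℝ => (m + 1 : ℂ) * (t : ℂ) ^ m) (Icc 0 1) := by fun_prop
  induction k with
  | zero =>
    have h := intervalIntegral.integral_eq_sub_of_hasDerivAt (a := 0) (b := 1)
      (fun t ht => hd t (by rwa [uIcc_of_le zero_le_one] at ht))
      (ContinuousOn.intervalIntegrable (by fun_prop))
    rw [intervalIntegral.integral_const_mul] at h
    simp only [pow_zero, one_mul, Nat.factorial_zero, Nat.cast_one, zero_add, pow_one]
    rw [eq_div_iff hm, mul_comm, h]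
    simp
  | succ k ih =>
    have h := integral_log_pow_succ_mul_deriv k hd hc (by simp)
    have h1 : ∫ t in (0 : ℝ)..1, (Real.log t : ℂ) ^ (k + 1) * ((m + 1 : ℂ) * (t : ℂ) ^ m) =
        (m + 1 : ℂ) * ∫ t in (0 : ℝ)..1, (Real.log t : ℂ) ^ (k + 1) * (t : ℂ) ^ m := by
      rw [← intervalIntegral.integral_const_mul]
      congr 1
      funext t
      ring
    have h2 : ∫ t in (0 : ℝ)..1, (Real.log t : ℂ) ^ k * (t : ℂ) ^ (m + 1) / t =
        ∫ t in (0 : ℝ)..1, (Real.log t : ℂ) ^ k * (t : ℂ) ^ m := by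
      refine intervalIntegral.integral_congr_ae (Eventually.of_forall fun t ht => ?_)
      rw [uIoc_of_le zero_le_one] at ht
      have ht0 : (t : ℂ) ≠ 0 := by exact_mod_cast ht.1.ne'
      field_simp
      ring
    rw [h1, h2, ih] at h
    rw [← mul_right_inj' hm, h, Nat.factorial_succ]
    push_cast
    field_simp
    ring

theorem lintegral_neg_log_pow_mul_pow (k m : ℕ) :
    ∫⁻ t in Ioo (0 : ℝ) 1, ENNReal.ofReal ((-Real.log t) ^ k * t ^ m) =
      ENNReal.ofReal (k.factorial / (m + 1 : ℝ) ^ (k + 1)) := by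
  have hi : IntervalIntegrable (fun t : ℝ => (Real.log t : ℂ) ^ k * (t : ℂ) ^ m) volume 0 1 :=
    intervalIntegrable_log_pow_mul (C := 1) k (by fun_prop) fun t ht => by
      rw [norm_pow, Complex.norm_real, Real.norm_of_nonneg ht.1.le]
      exact pow_le_one₀ ht.1.le ht.2
  have e : ∀ t : ℝ, (Real.log t : ℂ) ^ k * (t : ℂ) ^ m =
      (-1) ^ k * (((-Real.log t) ^ k * t ^ m : ℝ) : ℂ) := by
    intro t
    push_cast
    rw [← mul_assoc, ← mul_pow]
    simp
  have hi' : IntegrableOn (fun t : ℝ => (-Real.log t) ^ k * t ^ m) (Ioo 0 1) := by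
    have h1 := hi.norm.1.mono_set Ioo_subset_Ioc_self
    refine h1.congr_fun (fun t ht => ?_) measurableSet_Ioo
    have hl : 0 ≤ -Real.log t := by linarith [Real.log_nonpos ht.1.le ht.2.le]
    simp only [e, norm_mul, norm_pow, norm_neg, norm_one, one_pow, one_mul, Complex.norm_real]
    rw [Real.norm_of_nonpos (by linarith), Real.norm_of_nonneg ht.1.le]
  rw [← ofReal_integral_eq_lintegral_ofReal hi']
  · congr 1
    have h := integral_log_pow_mul_pow k m
    simp_rw [e] at h
    rw [intervalIntegral.integral_const_mul, intervalIntegral.integral_ofReal,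
      intervalIntegral.integral_of_le zero_le_one, integral_Ioc_eq_integral_Ioo, mul_div_assoc,
      mul_right_inj' (pow_ne_zero _ (by norm_num))] at h
    refine Complex.ofReal_injective ?_
    push_cast
    exact h
  · refine (ae_restrict_iff' measurableSet_Ioo).2 (Eventually.of_forall fun t ht => ?_)
    have hl : 0 ≤ -Real.log t := by linarith [Real.log_nonpos ht.1.le ht.2.le]
    have := ht.1.le
    simp only [Pi.zero_apply]
    positivity

/-- Expand `-log(1-t)` in its power series and integrate termwise. All terms are nonnegative, so
Tonelli suffices and finiteness is a consequence rather than a hypothesis. -/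
theorem lintegral_nielsen_one (n : ℕ) :
    ∫⁻ t in Ioo (0 : ℝ) 1, ENNReal.ofReal ((-Real.log t) ^ n * (-Real.log (1 - t)) ^ 1 / t) =
      n.factorial * dirichletSum (n + 2) := by
  have h1 : ∀ t ∈ Ioo (0 : ℝ) 1,
      ENNReal.ofReal ((-Real.log t) ^ n * (-Real.log (1 - t)) ^ 1 / t) =
        ∑' i : ℕ, ENNReal.ofReal (1 / (i + 1)) * ENNReal.ofReal ((-Real.log t) ^ n * t ^ i) := by
    intro t ht
    have hl : 0 ≤ -Real.log t := by linarith [Real.log_nonpos ht.1.le ht.2.le]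
    have ht0 := ht.1
    have hs := (Real.hasSum_pow_div_log_of_abs_lt_one
      (show |t| < 1 by rw [abs_of_pos ht.1]; exact ht.2)).mul_left ((-Real.log t) ^ n / t)
    have e : (-Real.log t) ^ n * (-Real.log (1 - t)) ^ 1 / t =
        (-Real.log t) ^ n / t * -Real.log (1 - t) := by ring
    rw [e, ← hs.tsum_eq, ENNReal.ofReal_tsum_of_nonneg (fun _ => by positivity) hs.summable]
    refine tsum_congr fun i => ?_
    rw [← ENNReal.ofReal_mul (by positivity)]
    congr 1
    field_simp
    ring
  rw [setLIntegral_congr_fun measurableSet_Ioo h1, lintegral_tsum (fun i => by fun_prop),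
    dirichletSum, ← ENNReal.tsum_mul_left]
  refine tsum_congr fun i => ?_
  rw [lintegral_const_mul _ (by fun_prop), lintegral_neg_log_pow_mul_pow,
    ← ENNReal.ofReal_natCast, ← ENNReal.ofReal_mul (by positivity),
    ← ENNReal.ofReal_mul (by positivity)]
  congr 1
  field_simp
  ring

/-- Squaring the logarithmic series gives terms t^(m+k)/(mk); integrating against dt/t and the power
of `-log t` produces the factor (m+k)^(-(n+1)), hence a Tornheim sum. -/
theorem lintegral_nielsen_two (n : ℕ) :
    ∫⁻ t in Ioo (0 : ℝ) 1, ENNReal.ofReal ((-Real.log t) ^ n * (-Real.log (1 - t)) ^ 2 / t) =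
      n.factorial * tornheimSum 1 1 (n + 1) := by
  have h1 : ∀ t ∈ Ioo (0 : ℝ) 1,
      ENNReal.ofReal ((-Real.log t) ^ n * (-Real.log (1 - t)) ^ 2 / t) =
        ∑' (i : ℕ) (j : ℕ), ENNReal.ofReal (1 / ((i + 1) * (j + 1))) *
          ENNReal.ofReal ((-Real.log t) ^ n * t ^ (i + j + 1)) := by
    intro t ht
    have hl : 0 ≤ -Real.log t := by linarith [Real.log_nonpos ht.1.le ht.2.le]
    have hl' : 0 ≤ -Real.log (1 - t) := by
      linarith [Real.log_nonpos (by linarith [ht.2] : 0 ≤ 1 - t) (by linarith [ht.1])]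
    have ht0 := ht.1
    have hs := Real.hasSum_pow_div_log_of_abs_lt_one
      (show |t| < 1 by rw [abs_of_pos ht.1]; exact ht.2)
    have e : (-Real.log t) ^ n * (-Real.log (1 - t)) ^ 2 / t =
        (-Real.log t) ^ n / t * (-Real.log (1 - t) * -Real.log (1 - t)) := by ring
    rw [e, ENNReal.ofReal_mul (by positivity), ENNReal.ofReal_mul hl', ← hs.tsum_eq,
      ENNReal.ofReal_tsum_of_nonneg (fun _ => by positivity) hs.summable,
      ← ENNReal.tsum_mul_right, ← ENNReal.tsum_mul_left]
    refine tsum_congr fun i => ?_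
    rw [← ENNReal.tsum_mul_left, ← ENNReal.tsum_mul_left]
    refine tsum_congr fun j => ?_
    rw [← ENNReal.ofReal_mul (by positivity), ← ENNReal.ofReal_mul (by positivity),
      ← ENNReal.ofReal_mul (by positivity)]
    congr 1
    field_simp
    ring
  rw [setLIntegral_congr_fun measurableSet_Ioo h1,
    lintegral_tsum (fun i => (Measurable.tsum fun j => by fun_prop).aemeasurable),
    tornheimSum, ← ENNReal.tsum_mul_left]
  refine tsum_congr fun i => ?_
  rw [lintegral_tsum (fun i => by fun_prop), ← ENNReal.tsum_mul_left]
  refine tsum_congr fun j => ?_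
  rw [lintegral_const_mul _ (by fun_prop), lintegral_neg_log_pow_mul_pow,
    ← ENNReal.ofReal_natCast, ← ENNReal.ofReal_mul (by positivity),
    ← ENNReal.ofReal_mul (by positivity)]
  congr 1
  push_cast
  have : (i : ℝ) + j + 1 + 1 = i + j + 2 := by ring
  rw [this]
  field_simp

/-- For real arguments in [0,1] the complex logarithms are real. Pulling out the signs leaves a
nonnegative integrand, suited to monotone comparison. -/
theorem nielsenIntegrand_eq (n p : ℕ) {t x : ℝ} (ht : t ∈ Ioo (0 : ℝ) 1) (hx : x ∈ Icc (0 : ℝ) 1) :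
    (Real.log t : ℂ) ^ n * Complex.log (1 - (1 - x) * (t : ℂ)) ^ p / (t : ℂ) =
      (-1) ^ (n + p) * (((-Real.log t) ^ n * (-Real.log (1 - (1 - x) * t)) ^ p / t : ℝ) : ℂ) := by
  have h : 0 ≤ 1 - (1 - x) * t := by nlinarith [ht.1, ht.2, hx.1, hx.2]
  push_cast
  rw [Complex.ofReal_log h, pow_add, neg_pow (Real.log t : ℂ), neg_pow (Complex.log _)]
  have h1 : ((-1 : ℂ) ^ n) * (-1) ^ n = 1 := by rw [← mul_pow]; simp
  have h2 : ((-1 : ℂ) ^ p) * (-1) ^ p = 1 := by rw [← mul_pow]; simp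
  push_cast
  linear_combination (-(Real.log t : ℂ) ^ n * Complex.log (1 - (1 - x) * (t : ℂ)) ^ p / (t : ℂ)) *
    (((-1 : ℂ) ^ p) * (-1) ^ p * h1 + h2)

theorem neg_log_pow_mul_div_nonneg (n p : ℕ) {t : ℝ} (ht : t ∈ Ioo (0 : ℝ) 1) :
    0 ≤ (-Real.log t) ^ n * (-Real.log (1 - t)) ^ p / t := by
  have hl : 0 ≤ -Real.log t := by linarith [Real.log_nonpos ht.1.le ht.2.le]
  have hl' : 0 ≤ -Real.log (1 - t) := by
    linarith [Real.log_nonpos (by linarith [ht.2] : 0 ≤ 1 - t) (by linarith [ht.1])]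
  have := ht.1
  positivity

theorem integrableOn_neg_log_pow_mul_div (n p : ℕ)
    (h : ∫⁻ t in Ioo (0 : ℝ) 1, ENNReal.ofReal ((-Real.log t) ^ n * (-Real.log (1 - t)) ^ p / t) ≠ ∞) :
    IntegrableOn (fun t : ℝ => (-Real.log t) ^ n * (-Real.log (1 - t)) ^ p / t) (Ioo 0 1) := by
  refine ⟨(Measurable.div (by fun_prop) measurable_id).aestronglyMeasurable, ?_⟩
  rw [hasFiniteIntegral_iff_ofReal]
  · exact h.lt_top
  · exact (ae_restrict_iff' measurableSet_Ioo).2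
      (Eventually.of_forall fun t ht => neg_log_pow_mul_div_nonneg n p ht)

theorem nielsenS_at_one (n p : ℕ) :
    nielsenS (n + 1) p 1 = 1 / (n.factorial * p.factorial) *
      ((∫⁻ t in Ioo (0 : ℝ) 1,
        ENNReal.ofReal ((-Real.log t) ^ n * (-Real.log (1 - t)) ^ p / t)).toReal : ℂ) := by
  rw [← integral_eq_lintegral_of_nonneg_ae ((ae_restrict_iff' measurableSet_Ioo).2
      (Eventually.of_forall fun t ht => neg_log_pow_mul_div_nonneg n p ht))
      (Measurable.div (by fun_prop) measurable_id).aestronglyMeasurable,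
    nielsenS, intervalIntegral.integral_of_le zero_le_one, integral_Ioc_eq_integral_Ioo]
  have h1 : ∫ t in Ioo (0 : ℝ) 1,
      (Real.log t : ℂ) ^ (n + 1 - 1) * Complex.log (1 - 1 * (t : ℂ)) ^ p / (t : ℂ) =
      ∫ t in Ioo (0 : ℝ) 1, (-1) ^ (n + p) *
        (((-Real.log t) ^ n * (-Real.log (1 - t)) ^ p / t : ℝ) : ℂ) := by
    refine setIntegral_congr_fun measurableSet_Ioo fun t ht => ?_
    have := nielsenIntegrand_eq n p ht (x := 0) (by simp)
    simpa using this
  rw [h1, integral_const_mul, integral_complex_ofReal, show n + 1 + p - 1 = n + p by omega]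
  have h2 : ((-1 : ℂ) ^ (n + p)) * (-1) ^ (n + p) = 1 := by rw [← mul_pow]; simp
  simp only [Nat.add_sub_cancel]
  linear_combination (1 / (n.factorial * p.factorial : ℂ)) *
    ((∫ t in Ioo (0 : ℝ) 1, (-Real.log t) ^ n * (-Real.log (1 - t)) ^ p / t : ℝ) : ℂ) * h2

/-- Abel-type continuity of the Nielsen polylogarithm at the branch point. -/
theorem tendsto_nielsenS_one_sub (n p : ℕ)
    (h : ∫⁻ t in Ioo (0 : ℝ) 1, ENNReal.ofReal ((-Real.log t) ^ n * (-Real.log (1 - t)) ^ p / t) ≠ ∞) :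
    Tendsto (fun x : ℝ => nielsenS (n + 1) p (1 - x)) (𝓝[>] 0) (𝓝 (nielsenS (n + 1) p 1)) := by
  unfold nielsenS
  refine Tendsto.const_mul _ ?_
  simp_rw [intervalIntegral.integral_of_le zero_le_one, integral_Ioc_eq_integral_Ioo]
  refine tendsto_integral_filter_of_dominated_convergence
    (fun t => (-Real.log t) ^ n * (-Real.log (1 - t)) ^ p / t) ?_ ?_
    (integrableOn_neg_log_pow_mul_div n p h) ?_
  · exact Eventually.of_forall fun x =>
      (Measurable.div (by fun_prop) Complex.measurable_ofReal).aestronglyMeasurable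
  · filter_upwards [Ioo_mem_nhdsGT (zero_lt_one' ℝ)] with x hx
    refine (ae_restrict_iff' measurableSet_Ioo).2 (Eventually.of_forall fun t ht => ?_)
    have h0 := ht.1
    have h3 : x * t ≤ 1 * t := mul_le_mul_of_nonneg_right hx.2.le h0.le
    have h4 : 0 < x * t := mul_pos hx.1 h0
    have hl : 0 ≤ -Real.log t := by linarith [Real.log_nonpos ht.1.le ht.2.le]
    have hl' : 0 ≤ -Real.log (1 - (1 - x) * t) := by
      linarith [Real.log_nonpos (by linarith [ht.2] : 0 ≤ 1 - (1 - x) * t) (by linarith)]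
    -- Monotonicity of the logarithm makes the integrand at the endpoint 1 a majorant for all points
    -- `1 - x`.
    have hl'' : Real.log (1 - t) ≤ Real.log (1 - (1 - x) * t) :=
      Real.log_le_log (by linarith [ht.2]) (by linarith)
    rw [Nat.add_sub_cancel, nielsenIntegrand_eq n p ht (Ioo_subset_Icc_self hx), norm_mul, norm_pow,
      norm_neg, norm_one, one_pow, one_mul, Complex.norm_real, Real.norm_of_nonneg (by positivity)]
    gcongr
  · refine (ae_restrict_iff' measurableSet_Ioo).2 (Eventually.of_forall fun t ht => ?_)
    have hs : (1 - (1 - ((0 : ℝ) : ℂ)) * (t : ℂ)) ∈ Complex.slitPlane := by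
      left
      simpa using ht.2
    have hc : ContinuousAt (fun x : ℝ => (Real.log t : ℂ) ^ (n + 1 - 1) *
        Complex.log (1 - (1 - (x : ℂ)) * (t : ℂ)) ^ p / (t : ℂ)) 0 := by
      refine ContinuousAt.div_const (ContinuousAt.mul continuousAt_const (ContinuousAt.pow ?_ _)) _
      exact ContinuousAt.clog (by fun_prop) hs
    have := hc.tendsto.mono_left (nhdsWithin_le_nhds (s := Ioi 0))
    simpa using this

theorem tendsto_nielsenS_one_one_sub (n : ℕ) :
    Tendsto (fun x : ℝ => nielsenS (n + 1) 1 (1 - x)) (𝓝[>] 0) (𝓝 (riemannZeta (n + 2 : ℕ))) := by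
  have h := lintegral_nielsen_one n
  have ht : ∫⁻ t in Ioo (0 : ℝ) 1,
      ENNReal.ofReal ((-Real.log t) ^ n * (-Real.log (1 - t)) ^ 1 / t) ≠ ∞ := by
    rw [h]
    exact ENNReal.mul_ne_top (ENNReal.natCast_ne_top _) (dirichletSum_ne_top (by omega))
  have h2 := nielsenS_at_one n 1
  have hf : ((n.factorial : ℕ) : ℂ) ≠ 0 := by exact_mod_cast n.factorial_ne_zero
  rw [h, ENNReal.toReal_mul, ENNReal.toReal_natCast] at h2
  push_cast at h2
  rw [riemannZeta_eq_dirichletSum (by omega)]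
  convert! tendsto_nielsenS_one_sub n 1 ht using 2
  rw [h2]
  simp
  field_simp

theorem tendsto_nielsenS_two_one_sub (n : ℕ) :
    Tendsto (fun x : ℝ => nielsenS (n + 1) 2 (1 - x)) (𝓝[>] 0)
      (𝓝 ((tornheimSum 1 0 (n + 2)).toReal : ℂ)) := by
  have h := lintegral_nielsen_two n
  have ht : ∫⁻ t in Ioo (0 : ℝ) 1,
      ENNReal.ofReal ((-Real.log t) ^ n * (-Real.log (1 - t)) ^ 2 / t) ≠ ∞ := by
    rw [h]
    exact ENNReal.mul_ne_top (ENNReal.natCast_ne_top _) (tornheimSum_one_one_ne_top n)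
  have h2 := nielsenS_at_one n 2
  have hf : ((n.factorial : ℕ) : ℂ) ≠ 0 := by exact_mod_cast n.factorial_ne_zero
  have h0 := tornheimSum_one_zero_ne_top n
  rw [h, ENNReal.toReal_mul, ENNReal.toReal_natCast, tornheimSum_one_one,
    ENNReal.toReal_add h0 h0] at h2
  push_cast at h2
  convert! tendsto_nielsenS_one_sub n 2 ht using 2
  rw [h2]
  simp
  field_simp
  ring

theorem tendsto_nielsenS_one_two_one_sub :
    Tendsto (fun x : ℝ => nielsenS 1 2 (1 - x)) (𝓝[>] 0) (𝓝 (riemannZeta 3)) := by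
  have h := tendsto_nielsenS_two_one_sub 0
  rw [zero_add, tornheimSum_one_zero_two, ← riemannZeta_eq_dirichletSum (by norm_num)] at h
  exact_mod_cast h

theorem tendsto_nielsenS_two_two_one_sub :
    Tendsto (fun x : ℝ => nielsenS 2 2 (1 - x)) (𝓝[>] 0) (𝓝 (1 / 4 * riemannZeta 4)) := by
  have h := tendsto_nielsenS_two_one_sub 1
  convert! h using 2
  have h1 := congrArg (fun x : ℝ => (x : ℂ)) tornheimSum_one_zero_three
  have h2 := riemannZeta_eq_dirichletSum (le_refl 2)
  have h4 := riemannZeta_eq_dirichletSum (show 2 ≤ 4 by norm_num)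
  push_cast at h1 h2 h4
  rw [← h2, ← h4, riemannZeta_two_sq] at h1
  linear_combination -(1 / 2) * h1

theorem tendsto_nielsenS_three_two_one_sub :
    Tendsto (fun x : ℝ => nielsenS 3 2 (1 - x)) (𝓝[>] 0)
      (𝓝 (2 * riemannZeta 5 - riemannZeta 2 * riemannZeta 3)) := by
  have h := tendsto_nielsenS_two_one_sub 2
  convert! h using 2
  have h1 := congrArg (fun x : ℝ => (x : ℂ)) tornheimSum_one_zero_four
  have h2 := riemannZeta_eq_dirichletSum (le_refl 2)
  have h3 := riemannZeta_eq_dirichletSum (show 2 ≤ 3 by norm_num)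
  have h5 := riemannZeta_eq_dirichletSum (show 2 ≤ 5 by norm_num)
  push_cast at h1 h2 h3 h5
  rw [← h2, ← h3, ← h5] at h1
  exact h1.symm

/-- Twice the limit is 5ζ(6) - 2ζ(2)ζ(4) - ζ(3)², and ζ(2)ζ(4) = (7/4)ζ(6). -/
theorem tendsto_nielsenS_four_two_one_sub :
    Tendsto (fun x : ℝ => nielsenS 4 2 (1 - x)) (𝓝[>] 0)
      (𝓝 (3 / 4 * riemannZeta 6 - 1 / 2 * riemannZeta 3 ^ 2)) := by
  have h := tendsto_nielsenS_two_one_sub 3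
  convert! h using 2
  have h1 := congrArg (fun x : ℝ => (x : ℂ)) tornheimSum_one_zero_five
  have h2 := riemannZeta_eq_dirichletSum (le_refl 2)
  have h3 := riemannZeta_eq_dirichletSum (show 2 ≤ 3 by norm_num)
  have h4 := riemannZeta_eq_dirichletSum (show 2 ≤ 4 by norm_num)
  have h6 := riemannZeta_eq_dirichletSum (show 2 ≤ 6 by norm_num)
  push_cast at h1 h2 h3 h4 h6
  rw [← h2, ← h3, ← h4, ← h6] at h1
  linear_combination -(1 / 2) * h1 + riemannZeta_two_mul_four

end ValuesAtOne

/-! ### Geometry of the doubly cut plane and derivatives at `1 - z` and `z / (z - 1)`. -/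

section CutPlane

open Set Filter Topology

theorem mem_cutPlane_iff {z : ℂ} :
    z ∈ cutPlane ↔ z ∈ Complex.slitPlane ∧ 1 - z ∈ Complex.slitPlane := by
  have h1 : z ∈ cutPlane ↔ ¬ (z.im = 0 ∧ (z.re ≤ 0 ∨ 1 ≤ z.re)) := by
    rw [cutPlane, mem_compl_iff, not_iff_not]
    constructor
    · rintro ⟨x, hx, rfl⟩
      simpa using hx
    · rintro ⟨h, h'⟩
      exact ⟨z.re, h', Complex.ext (by simp) (by simp [h])⟩
  rw [h1, Complex.mem_slitPlane_iff, Complex.mem_slitPlane_iff]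
  simp only [Complex.sub_re, Complex.one_re, Complex.sub_im, Complex.one_im, zero_sub, ne_eq,
    neg_eq_zero, sub_pos]
  by_cases h : z.im = 0
  · simp [h]
  · simp [h]

theorem isOpen_cutPlane : IsOpen cutPlane := by
  have h : cutPlane = Complex.slitPlane ∩ rayCutPlane := ext fun _ => mem_cutPlane_iff
  rw [h]
  exact Complex.isOpen_slitPlane.inter isOpen_rayCutPlane

theorem starConvex_cutPlane : StarConvex ℝ (1 / 2 : ℂ) cutPlane := by
  have hs : StarConvex ℝ (1 / 2 : ℂ) Complex.slitPlane := by
    have := Complex.starConvex_ofReal_slitPlane (x := 1 / 2) (by norm_num)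
    simpa using this
  intro z hz a b ha hb hab
  rw [mem_cutPlane_iff] at hz ⊢
  refine ⟨hs hz.1 ha hb hab, ?_⟩
  have e : 1 - (a • (1 / 2 : ℂ) + b • z) = a • (1 / 2 : ℂ) + b • (1 - z) := by
    have : (a : ℂ) + b = 1 := by exact_mod_cast hab
    simp only [Complex.real_smul]
    linear_combination -this
  rw [e]
  exact hs hz.2 ha hb hab

theorem ofReal_mem_cutPlane {x : ℝ} (hx : x ∈ Ioo (0 : ℝ) 1) : (x : ℂ) ∈ cutPlane := by
  rw [mem_cutPlane_iff]
  exact ⟨Or.inl (by simpa using hx.1), Or.inl (by simpa using hx.2)⟩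

theorem cutPlane_subset_rayCutPlane : cutPlane ⊆ rayCutPlane := fun _ hz =>
  (mem_cutPlane_iff.1 hz).2

theorem one_sub_mem_cutPlane {z : ℂ} (hz : z ∈ cutPlane) : 1 - z ∈ cutPlane := by
  rw [mem_cutPlane_iff] at hz ⊢
  rw [sub_sub_cancel]
  exact hz.symm

theorem ne_zero_of_mem_cutPlane {z : ℂ} (hz : z ∈ cutPlane) : z ≠ 0 :=
  Complex.slitPlane_ne_zero (mem_cutPlane_iff.1 hz).1

theorem one_sub_ne_zero_of_mem_cutPlane {z : ℂ} (hz : z ∈ cutPlane) : 1 - z ≠ 0 :=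
  Complex.slitPlane_ne_zero (mem_cutPlane_iff.1 hz).2

theorem one_sub_div_sub_one {z : ℂ} (hz : 1 - z ≠ 0) : 1 - z / (z - 1) = (1 - z)⁻¹ := by
  have h : z - 1 ≠ 0 := fun h => hz (by linear_combination -h)
  field_simp
  ring

/-- Since 1 - z/(z-1) = 1/(1-z), the claim is that the slit plane is stable under inversion. -/
theorem div_sub_one_mem_rayCutPlane {z : ℂ} (hz : z ∈ rayCutPlane) : z / (z - 1) ∈ rayCutPlane := by
  change 1 - z / (z - 1) ∈ Complex.slitPlane
  rw [one_sub_div_sub_one (Complex.slitPlane_ne_zero hz)]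
  rw [Complex.mem_slitPlane_iff_arg, Complex.arg_inv, if_neg (Complex.slitPlane_arg_ne_pi hz)]
  have h := Complex.mem_slitPlane_iff_arg.1 hz
  exact ⟨fun h' => (Complex.neg_pi_lt_arg (1 - z)).ne (by linarith), inv_ne_zero h.2⟩

theorem log_one_sub_div_sub_one {z : ℂ} (hz : z ∈ rayCutPlane) :
    Complex.log (1 - z / (z - 1)) = -Complex.log (1 - z) := by
  rw [one_sub_div_sub_one (Complex.slitPlane_ne_zero hz),
    Complex.log_inv _ (Complex.slitPlane_arg_ne_pi hz)]

/-- A function with zero derivative on the doubly cut plane and zero limit at the origin along the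
positive real axis vanishes. -/
theorem eq_zero_of_hasDerivAt_zero {F : ℂ → ℂ} (hF : ∀ z ∈ cutPlane, HasDerivAt F 0 z)
    (hlim : Tendsto (fun x : ℝ => F x) (𝓝[>] 0) (𝓝 0)) {z : ℂ} (hz : z ∈ cutPlane) : F z = 0 := by
  have hmem : (1 / 2 : ℂ) ∈ cutPlane := by
    have := ofReal_mem_cutPlane (x := 1 / 2) (mem_Ioo.2 ⟨by norm_num, by norm_num⟩)
    simpa using this
  have hpre : IsPreconnected cutPlane :=
    (starConvex_cutPlane.isPathConnected hmem).isConnected.isPreconnected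
  have hconst : ∀ w ∈ cutPlane, F w = F z := fun w hw =>
    isOpen_cutPlane.is_const_of_deriv_eq_zero hpre
      (fun u hu => (hF u hu).differentiableAt.differentiableWithinAt)
      (fun u hu => (hF u hu).deriv) hw hz
  refine tendsto_nhds_unique (tendsto_const_nhds.congr' ?_) hlim
  filter_upwards [Ioo_mem_nhdsGT (zero_lt_one' ℝ)] with x hx
  exact (hconst x (ofReal_mem_cutPlane hx)).symm

theorem hasDerivAt_nielsenS_one_sub (n p : ℕ) {z : ℂ} (hz : z ∈ cutPlane) :
    HasDerivAt (fun z : ℂ => nielsenS (n + 2) (p + 1) (1 - z))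
      (-(nielsenS (n + 1) (p + 1) (1 - z) / (1 - z))) z := by
  have h := hasDerivAt_nielsenS_succ n p (cutPlane_subset_rayCutPlane (one_sub_mem_cutPlane hz))
    (one_sub_ne_zero_of_mem_cutPlane hz)
  simpa [Function.comp_def] using h.comp z ((hasDerivAt_id z).const_sub 1)

theorem hasDerivAt_nielsenS_one_one_sub (p : ℕ) {z : ℂ} (hz : z ∈ cutPlane) :
    HasDerivAt (fun z : ℂ => nielsenS 1 (p + 1) (1 - z))
      (-((-1) ^ (p + 1) / (p + 1).factorial * Complex.log z ^ (p + 1) / (1 - z))) z := by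
  have h := hasDerivAt_nielsenS_one p (cutPlane_subset_rayCutPlane (one_sub_mem_cutPlane hz))
    (one_sub_ne_zero_of_mem_cutPlane hz)
  simpa [Function.comp_def] using h.comp z ((hasDerivAt_id z).const_sub 1)

theorem hasDerivAt_div_sub_one {z : ℂ} (hz : z ∈ rayCutPlane) :
    HasDerivAt (fun z : ℂ => z / (z - 1)) (-(1 / (z - 1) ^ 2)) z := by
  have h : z - 1 ≠ 0 := fun h => Complex.slitPlane_ne_zero hz (by linear_combination -h)
  convert! (hasDerivAt_id z).div ((hasDerivAt_id z).sub_const 1) h using 1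
  simp
  field_simp

/-- The logarithmic derivative of z/(z-1) is 1/z + 1/(1-z). -/
theorem hasDerivAt_nielsenS_div_sub_one (n : ℕ) {z : ℂ} (hz : z ∈ cutPlane) :
    HasDerivAt (fun z : ℂ => nielsenS (n + 2) 1 (z / (z - 1)))
      (nielsenS (n + 1) 1 (z / (z - 1)) * (1 / z + 1 / (1 - z))) z := by
  have hr := cutPlane_subset_rayCutPlane hz
  have h0 := ne_zero_of_mem_cutPlane hz
  have h1 := one_sub_ne_zero_of_mem_cutPlane hz
  have h1' : z - 1 ≠ 0 := fun h => h1 (by linear_combination -h)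
  have h := (hasDerivAt_nielsenS_succ n 0 (div_sub_one_mem_rayCutPlane hr)
    (div_ne_zero h0 h1')).comp z (hasDerivAt_div_sub_one hr)
  refine h.congr_deriv ?_
  field_simp
  ring

theorem hasDerivAt_nielsenS_one_div_sub_one {z : ℂ} (hz : z ∈ cutPlane) :
    HasDerivAt (fun z : ℂ => nielsenS 1 1 (z / (z - 1)))
      (Complex.log (1 - z) * (1 / z + 1 / (1 - z))) z := by
  have hr := cutPlane_subset_rayCutPlane hz
  have h0 := ne_zero_of_mem_cutPlane hz
  have h1 := one_sub_ne_zero_of_mem_cutPlane hz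
  have h1' : z - 1 ≠ 0 := fun h => h1 (by linear_combination -h)
  have h := (hasDerivAt_nielsenS_one 0 (div_sub_one_mem_rayCutPlane hr)
    (div_ne_zero h0 h1')).comp z (hasDerivAt_div_sub_one hr)
  refine h.congr_deriv ?_
  simp only [zero_add, pow_one, log_one_sub_div_sub_one hr, Nat.factorial_one, Nat.cast_one]
  field_simp
  ring

end CutPlane

/-! ### Functions that vanish at 0 faster than any power of the logarithm grows. -/

section LogSmall

open Set Filter Topology

/-- A function on the positive reals that tends to zero at the origin even after multiplication by
any power of the logarithm. -/
def LogSmall (f : ℝ → ℂ) : Prop :=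
  ∀ k : ℕ, Tendsto (fun x : ℝ => Complex.log x ^ k * f x) (𝓝[>] 0) (𝓝 0)

namespace LogSmall

variable {f g : ℝ → ℂ}

theorem tendsto_zero (hf : LogSmall f) : Tendsto f (𝓝[>] 0) (𝓝 0) := by
  simpa using hf 0

theorem add (hf : LogSmall f) (hg : LogSmall g) : LogSmall fun x => f x + g x := fun k => by
  simpa [mul_add] using (hf k).add (hg k)

theorem sub (hf : LogSmall f) (hg : LogSmall g) : LogSmall fun x => f x - g x := fun k => by
  simpa [mul_sub] using (hf k).sub (hg k)

theorem neg (hf : LogSmall f) : LogSmall fun x => -f x := fun k => by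
  simpa using (hf k).neg

theorem const_mul (c : ℂ) (hf : LogSmall f) : LogSmall fun x => c * f x := fun k => by
  simpa [mul_left_comm] using (hf k).const_mul c

theorem mul (hf : LogSmall f) (hg : LogSmall g) : LogSmall fun x => f x * g x := fun k => by
  simpa [mul_assoc] using (hf k).mul hg.tendsto_zero

theorem pow_succ (hf : LogSmall f) (n : ℕ) : LogSmall fun x => f x ^ (n + 1) := by
  induction n with
  | zero => simpa using hf
  | succ n ih =>
    simp_rw [_root_.pow_succ _ (n + 1)]
    exact ih.mul hf

theorem log_pow_mul (n : ℕ) (hf : LogSmall f) : LogSmall fun x => Complex.log x ^ n * f x :=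
  fun k => by
    simpa [pow_add, mul_assoc] using hf (k + n)

theorem log_mul (hf : LogSmall f) : LogSmall fun x => Complex.log x * f x := by
  simpa using hf.log_pow_mul 1

/-- Transfers smallness across an identity known only on the cut plane: the real points of (0,1) lie
there. -/
theorem congr_cutPlane {F G : ℂ → ℂ} (hF : LogSmall fun x => F x) (h : ∀ z ∈ cutPlane, G z = F z) :
    LogSmall fun x => G x := fun k => by
  refine (hF k).congr' ?_
  filter_upwards [Ioo_mem_nhdsGT (zero_lt_one' ℝ)] with x hx
  rw [h x (ofReal_mem_cutPlane hx)]

/-- Differentiability gives F(x) = O(x), against O(x^(-1/2)) for any fixed power of the logarithm.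
-/
theorem of_differentiableAt {F : ℂ → ℂ} (hF : DifferentiableAt ℂ F 0) (h0 : F 0 = 0) :
    LogSmall fun x => F x := fun k => by
  obtain ⟨C, hC⟩ := hF.hasDerivAt.isBigO_sub.bound
  simp only [h0, sub_zero] at hC
  have hC' : ∀ᶠ x : ℝ in 𝓝[>] 0, ‖F x‖ ≤ C * ‖(x : ℂ)‖ := by
    have ht : Tendsto (fun x : ℝ => (x : ℂ)) (𝓝[>] 0) (𝓝 0) := by
      have := Complex.continuous_ofReal.tendsto 0
      rw [Complex.ofReal_zero] at this
      exact this.mono_left nhdsWithin_le_nhds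
    exact ht.eventually hC
  have hlim : Tendsto (fun x : ℝ => (2 * (k + 1) : ℝ) ^ k * C * x ^ (1 / 2 : ℝ)) (𝓝[>] 0) (𝓝 0) := by
    have := ((Real.continuous_rpow_const (show (0 : ℝ) ≤ 1 / 2 by norm_num)).tendsto 0).const_mul
      ((2 * (k + 1) : ℝ) ^ k * C)
    rw [Real.zero_rpow (by norm_num), mul_zero] at this
    exact this.mono_left nhdsWithin_le_nhds
  refine squeeze_zero_norm' ?_ hlim
  filter_upwards [hC', Ioo_mem_nhdsGT (zero_lt_one' ℝ)] with x hx hx1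
  have e : x ^ (1 / 2 : ℝ) = x ^ (-(1 / 2) : ℝ) * x := by
    rw [← Real.rpow_add_one hx1.1.ne']
    norm_num
  rw [Complex.norm_real, Real.norm_of_nonneg hx1.1.le] at hx
  rw [norm_mul, norm_pow, ← Complex.ofReal_log hx1.1.le, Complex.norm_real, Real.norm_eq_abs]
  have := Real.rpow_nonneg hx1.1.le (-(1 / 2))
  calc _ ≤ (2 * (k + 1) : ℝ) ^ k * x ^ (-(1 / 2) : ℝ) * (C * x) :=
        mul_le_mul (Real.abs_log_pow_le_rpow k hx1.1 hx1.2.le) hx (norm_nonneg _) (by positivity)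
    _ = _ := by
        rw [e]
        ring

end LogSmall

theorem zero_mem_rayCutPlane : (0 : ℂ) ∈ rayCutPlane := by
  simp [rayCutPlane]

theorem logSmall_log_one_sub : LogSmall fun x => Complex.log (1 - (x : ℂ)) :=
  LogSmall.of_differentiableAt (F := fun z => Complex.log (1 - z))
    (hasDerivAt_log_one_sub zero_mem_rayCutPlane).differentiableAt (by simp)

theorem logSmall_nielsenS (n p : ℕ) : LogSmall fun x => nielsenS n (p + 1) (x : ℂ) :=
  LogSmall.of_differentiableAt (differentiableAt_nielsenS n p zero_mem_rayCutPlane)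
    (nielsenS_zero n p)

theorem logSmall_nielsenS_div_sub_one (n p : ℕ) :
    LogSmall fun x => nielsenS n (p + 1) ((x : ℂ) / (x - 1)) := by
  refine LogSmall.of_differentiableAt (F := fun z => nielsenS n (p + 1) (z / (z - 1))) ?_
    (by simpa using nielsenS_zero n p)
  refine DifferentiableAt.comp (0 : ℂ) (g := nielsenS n (p + 1)) ?_
    (hasDerivAt_div_sub_one zero_mem_rayCutPlane).differentiableAt
  exact differentiableAt_nielsenS n p (div_sub_one_mem_rayCutPlane zero_mem_rayCutPlane)

/-- The asymmetry is deliberate: for `F`, built from values at `1 - z`, only a limit is available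
beforehand, while `G` is assembled from terms visibly `LogSmall`. -/
theorem eq_of_hasDerivAt_sub_of_logSmall {F G : ℂ → ℂ}
    (hd : ∀ z ∈ cutPlane, HasDerivAt (fun z => F z - G z) 0 z)
    (hF : Tendsto (fun x : ℝ => F x) (𝓝[>] 0) (𝓝 0)) (hG : LogSmall fun x => G x)
    {z : ℂ} (hz : z ∈ cutPlane) : F z = G z :=
  sub_eq_zero.1 (eq_zero_of_hasDerivAt_zero hd (by simpa using hF.sub hG.tendsto_zero) hz)

end LogSmall

/-! ### Derivative formulas with first index 1, signs and factorials evaluated. -/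

section Specializations

theorem hasDerivAt_log_of_mem_cutPlane {z : ℂ} (hz : z ∈ cutPlane) :
    HasDerivAt Complex.log (1 / z) z := by
  simpa using Complex.hasDerivAt_log (mem_cutPlane_iff.1 hz).1

theorem hasDerivAt_nielsenS_one_one {z : ℂ} (hz : z ∈ rayCutPlane) (hz0 : z ≠ 0) :
    HasDerivAt (nielsenS 1 1) (-Complex.log (1 - z) / z) z := by
  simpa using hasDerivAt_nielsenS_one 0 hz hz0

theorem hasDerivAt_nielsenS_one_two {z : ℂ} (hz : z ∈ rayCutPlane) (hz0 : z ≠ 0) :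
    HasDerivAt (nielsenS 1 2) (1 / 2 * Complex.log (1 - z) ^ 2 / z) z := by
  simpa using hasDerivAt_nielsenS_one 1 hz hz0

theorem hasDerivAt_nielsenS_one_three {z : ℂ} (hz : z ∈ rayCutPlane) (hz0 : z ≠ 0) :
    HasDerivAt (nielsenS 1 3) (-(1 / 6 * Complex.log (1 - z) ^ 3) / z) z := by
  refine (hasDerivAt_nielsenS_one 2 hz hz0).congr_deriv ?_
  norm_num [Nat.factorial]

theorem hasDerivAt_nielsenS_one_one_one_sub {z : ℂ} (hz : z ∈ cutPlane) :
    HasDerivAt (fun z : ℂ => nielsenS 1 1 (1 - z)) (Complex.log z / (1 - z)) z := by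
  refine (hasDerivAt_nielsenS_one_one_sub 0 hz).congr_deriv ?_
  norm_num
  ring

theorem hasDerivAt_nielsenS_one_two_one_sub {z : ℂ} (hz : z ∈ cutPlane) :
    HasDerivAt (fun z : ℂ => nielsenS 1 2 (1 - z)) (-(1 / 2 * Complex.log z ^ 2 / (1 - z))) z := by
  refine (hasDerivAt_nielsenS_one_one_sub 1 hz).congr_deriv ?_
  norm_num

end Specializations

/-! ### Landen and reflection formulas, weight by weight from 2 to 6. -/

section FunctionalEquations

open Filter Topology

theorem landen_dilogarithm {z : ℂ} (hz : z ∈ cutPlane) :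
    nielsenS 1 1 (z / (z - 1)) =
      -(nielsenS 1 1 z) - (1 / 2) * Complex.log (1 - z) ^ 2 := by
  refine eq_of_hasDerivAt_sub_of_logSmall (F := fun z => nielsenS 1 1 (z / (z - 1)))
    (G := fun z =>
      -(nielsenS 1 1 z) - (1 / 2) * Complex.log (1 - z) ^ 2)
    (fun w hw => ?_) ?_ ?_ hz
  · have hr := cutPlane_subset_rayCutPlane hw
    have h0 := ne_zero_of_mem_cutPlane hw
    have hb := hasDerivAt_log_one_sub hr
    refine HasDerivAt.congr_deriv
      ((hasDerivAt_nielsenS_one_div_sub_one hw).fun_sub ((hasDerivAt_nielsenS_one_one hr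
      h0).fun_neg.fun_sub ((hb.fun_pow 2).const_mul _))) ?_
    push_cast
    ring
  · exact (logSmall_nielsenS_div_sub_one 1 0).tendsto_zero
  · exact
      (LogSmall.sub (LogSmall.neg (logSmall_nielsenS 1 0)) (LogSmall.const_mul _
      (logSmall_log_one_sub.pow_succ 1)))

theorem reflection_dilogarithm {z : ℂ} (hz : z ∈ cutPlane) :
    nielsenS 1 1 (1 - z) - riemannZeta 2 =
      nielsenS 1 1 (z / (z - 1)) + (1 / 2) * Complex.log (1 - z) ^ 2
      - Complex.log z * Complex.log (1 - z) := by
  refine eq_of_hasDerivAt_sub_of_logSmall (F := fun z => nielsenS 1 1 (1 - z) - riemannZeta 2)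
    (G := fun z =>
      nielsenS 1 1 (z / (z - 1)) + (1 / 2) * Complex.log (1 - z) ^ 2
      - Complex.log z * Complex.log (1 - z))
    (fun w hw => ?_) ?_ ?_ hz
  · have hr := cutPlane_subset_rayCutPlane hw
    have ha := hasDerivAt_log_of_mem_cutPlane hw
    have hb := hasDerivAt_log_one_sub hr
    refine HasDerivAt.congr_deriv
      (((hasDerivAt_nielsenS_one_one_one_sub hw).sub_const _).fun_sub
      (((hasDerivAt_nielsenS_one_div_sub_one hw).fun_add ((hb.fun_pow 2).const_mul _)).fun_sub
      (ha.fun_mul hb))) ?_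
    push_cast
    ring
  · simpa using (tendsto_nielsenS_one_one_sub 0).sub_const (riemannZeta 2)
  · exact
      (LogSmall.sub (LogSmall.add (logSmall_nielsenS_div_sub_one 1 0) (LogSmall.const_mul _
      (logSmall_log_one_sub.pow_succ 1))) (LogSmall.log_mul logSmall_log_one_sub))

/-- Bootstrapping: dominated convergence gave only a limit, but the reflection formula upgrades it
to decay beating all powers of the logarithm. This is needed when the function is multiplied by `log
z` in the next formulas. -/
theorem logSmall_nielsenS_one_one_one_sub :
    LogSmall fun x => nielsenS 1 1 (1 - (x : ℂ)) - riemannZeta 2 := by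
  refine LogSmall.congr_cutPlane (F := fun z =>
      nielsenS 1 1 (z / (z - 1)) + (1 / 2) * Complex.log (1 - z) ^ 2
      - Complex.log z * Complex.log (1 - z))
    (G := fun z => nielsenS 1 1 (1 - z) - riemannZeta 2) ?_ fun _ hz => reflection_dilogarithm hz
  exact
    (LogSmall.sub (LogSmall.add (logSmall_nielsenS_div_sub_one 1 0) (LogSmall.const_mul _
    (logSmall_log_one_sub.pow_succ 1))) (LogSmall.log_mul logSmall_log_one_sub))

theorem landen_trilogarithm {z : ℂ} (hz : z ∈ cutPlane) :
    nielsenS 2 1 (z / (z - 1)) =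
      nielsenS 1 1 z * Complex.log (1 - z) + nielsenS 1 2 z + (1 / 6) * Complex.log (1 - z) ^ 3
      - nielsenS 2 1 z := by
  refine eq_of_hasDerivAt_sub_of_logSmall (F := fun z => nielsenS 2 1 (z / (z - 1)))
    (G := fun z =>
      nielsenS 1 1 z * Complex.log (1 - z) + nielsenS 1 2 z + (1 / 6) * Complex.log (1 - z) ^ 3
      - nielsenS 2 1 z)
    (fun w hw => ?_) ?_ ?_ hz
  · have hr := cutPlane_subset_rayCutPlane hw
    have h0 := ne_zero_of_mem_cutPlane hw
    have hb := hasDerivAt_log_one_sub hr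
    refine HasDerivAt.congr_deriv
      ((hasDerivAt_nielsenS_div_sub_one 0 hw).fun_sub (((((hasDerivAt_nielsenS_one_one hr
      h0).fun_mul hb).fun_add (hasDerivAt_nielsenS_one_two hr h0)).fun_add ((hb.fun_pow
      3).const_mul _)).fun_sub (hasDerivAt_nielsenS_succ 0 0 hr h0))) ?_
    push_cast
    -- The derivative of z/(z-1) contributes 1/w + 1/(1-w), so the weight 2 relation is used once
    -- with each coefficient.
    linear_combination 1 / w * landen_dilogarithm hw + 1 / (1 - w) * landen_dilogarithm hw
  · exact (logSmall_nielsenS_div_sub_one 2 0).tendsto_zero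
  · exact
      (LogSmall.sub (LogSmall.add (LogSmall.add (LogSmall.mul (logSmall_nielsenS 1 0)
      logSmall_log_one_sub) (logSmall_nielsenS 1 1)) (LogSmall.const_mul _
      (logSmall_log_one_sub.pow_succ 2))) (logSmall_nielsenS 2 0))

theorem reflection_trilogarithm {z : ℂ} (hz : z ∈ cutPlane) :
    nielsenS 2 1 (1 - z) - riemannZeta 3 =
      (1 / 6) * Complex.log (1 - z) ^ 3 + (riemannZeta 2) * Complex.log (1 - z) - nielsenS 2 1 z
      - nielsenS 2 1 (z / (z - 1)) - (1 / 2) * (Complex.log z * Complex.log (1 - z) ^ 2) := by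
  refine eq_of_hasDerivAt_sub_of_logSmall (F := fun z => nielsenS 2 1 (1 - z) - riemannZeta 3)
    (G := fun z =>
      (1 / 6) * Complex.log (1 - z) ^ 3 + (riemannZeta 2) * Complex.log (1 - z) - nielsenS 2 1 z
      - nielsenS 2 1 (z / (z - 1)) - (1 / 2) * (Complex.log z * Complex.log (1 - z) ^ 2))
    (fun w hw => ?_) ?_ ?_ hz
  · have hr := cutPlane_subset_rayCutPlane hw
    have h0 := ne_zero_of_mem_cutPlane hw
    have ha := hasDerivAt_log_of_mem_cutPlane hw
    have hb := hasDerivAt_log_one_sub hr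
    refine HasDerivAt.congr_deriv
      (((hasDerivAt_nielsenS_one_sub 0 0 hw).sub_const _).fun_sub ((((((hb.fun_pow 3).const_mul
      _).fun_add (hb.const_mul _)).fun_sub (hasDerivAt_nielsenS_succ 0 0 hr h0)).fun_sub
      (hasDerivAt_nielsenS_div_sub_one 0 hw)).fun_sub ((ha.fun_mul (hb.fun_pow 2)).const_mul _))) ?_
    push_cast
    linear_combination 1 / w * landen_dilogarithm hw + -(1 / (1 - w)) * reflection_dilogarithm hw
  · simpa using (tendsto_nielsenS_one_one_sub 1).sub_const (riemannZeta 3)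
  · exact
      (LogSmall.sub (LogSmall.sub (LogSmall.sub (LogSmall.add (LogSmall.const_mul _
      (logSmall_log_one_sub.pow_succ 2)) (LogSmall.const_mul _ logSmall_log_one_sub))
      (logSmall_nielsenS 2 0)) (logSmall_nielsenS_div_sub_one 2 0)) (LogSmall.const_mul _
      (LogSmall.log_mul (logSmall_log_one_sub.pow_succ 1))))

theorem logSmall_nielsenS_two_one_one_sub :
    LogSmall fun x => nielsenS 2 1 (1 - (x : ℂ)) - riemannZeta 3 := by
  refine LogSmall.congr_cutPlane (F := fun z =>
      (1 / 6) * Complex.log (1 - z) ^ 3 + (riemannZeta 2) * Complex.log (1 - z) - nielsenS 2 1 z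
      - nielsenS 2 1 (z / (z - 1)) - (1 / 2) * (Complex.log z * Complex.log (1 - z) ^ 2))
    (G := fun z => nielsenS 2 1 (1 - z) - riemannZeta 3) ?_ fun _ hz => reflection_trilogarithm hz
  exact
    (LogSmall.sub (LogSmall.sub (LogSmall.sub (LogSmall.add (LogSmall.const_mul _
    (logSmall_log_one_sub.pow_succ 2)) (LogSmall.const_mul _ logSmall_log_one_sub))
    (logSmall_nielsenS 2 0)) (logSmall_nielsenS_div_sub_one 2 0)) (LogSmall.const_mul _
    (LogSmall.log_mul (logSmall_log_one_sub.pow_succ 1))))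

theorem nielsenS_one_two_reflection {z : ℂ} (hz : z ∈ cutPlane) :
    nielsenS 1 2 (1 - z) - riemannZeta 3 =
      (nielsenS 2 1 (1 - z) - riemannZeta 3) + nielsenS 2 1 (z / (z - 1))
      + (1 / 2) * (Complex.log z * Complex.log (1 - z) ^ 2)
      - Complex.log z * (nielsenS 1 1 (1 - z) - riemannZeta 2)
      - (1 / 2) * (Complex.log z ^ 2 * Complex.log (1 - z)) - (1 / 6) * Complex.log (1 - z) ^ 3
      - (riemannZeta 2) * Complex.log (1 - z) := by
  refine eq_of_hasDerivAt_sub_of_logSmall (F := fun z => nielsenS 1 2 (1 - z) - riemannZeta 3)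
    (G := fun z =>
      (nielsenS 2 1 (1 - z) - riemannZeta 3) + nielsenS 2 1 (z / (z - 1))
      + (1 / 2) * (Complex.log z * Complex.log (1 - z) ^ 2)
      - Complex.log z * (nielsenS 1 1 (1 - z) - riemannZeta 2)
      - (1 / 2) * (Complex.log z ^ 2 * Complex.log (1 - z)) - (1 / 6) * Complex.log (1 - z) ^ 3
      - (riemannZeta 2) * Complex.log (1 - z))
    (fun w hw => ?_) ?_ ?_ hz
  · have hr := cutPlane_subset_rayCutPlane hw
    have ha := hasDerivAt_log_of_mem_cutPlane hw
    have hb := hasDerivAt_log_one_sub hr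
    refine HasDerivAt.congr_deriv
      (((hasDerivAt_nielsenS_one_two_one_sub hw).sub_const _).fun_sub
      ((((((((hasDerivAt_nielsenS_one_sub 0 0 hw).sub_const _).fun_add
      (hasDerivAt_nielsenS_div_sub_one 0 hw)).fun_add ((ha.fun_mul (hb.fun_pow 2)).const_mul
      _)).fun_sub (ha.fun_mul ((hasDerivAt_nielsenS_one_one_one_sub hw).sub_const _))).fun_sub
      (((ha.fun_pow 2).fun_mul hb).const_mul _)).fun_sub ((hb.fun_pow 3).const_mul _)).fun_sub
      (hb.const_mul _))) ?_
    push_cast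
    linear_combination 1 / w * reflection_dilogarithm hw + 1 / (1 - w) * reflection_dilogarithm hw
  · simpa using tendsto_nielsenS_one_two_one_sub.sub_const (riemannZeta 3)
  · exact
      (LogSmall.sub (LogSmall.sub (LogSmall.sub (LogSmall.sub (LogSmall.add (LogSmall.add
      logSmall_nielsenS_two_one_one_sub (logSmall_nielsenS_div_sub_one 2 0)) (LogSmall.const_mul
      _ (LogSmall.log_mul (logSmall_log_one_sub.pow_succ 1)))) (LogSmall.log_mul
      logSmall_nielsenS_one_one_one_sub)) (LogSmall.const_mul _ (LogSmall.log_pow_mul 2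
      logSmall_log_one_sub))) (LogSmall.const_mul _ (logSmall_log_one_sub.pow_succ 2)))
      (LogSmall.const_mul _ logSmall_log_one_sub))

theorem landen_tetralogarithm {z : ℂ} (hz : z ∈ cutPlane) :
    nielsenS 3 1 (z / (z - 1)) =
      nielsenS 2 1 z * Complex.log (1 - z) + nielsenS 2 2 z
      - (1 / 2) * (nielsenS 1 1 z * Complex.log (1 - z) ^ 2)
      - nielsenS 1 2 z * Complex.log (1 - z) - nielsenS 1 3 z - nielsenS 3 1 z
      - (1 / 24) * Complex.log (1 - z) ^ 4 := by
  refine eq_of_hasDerivAt_sub_of_logSmall (F := fun z => nielsenS 3 1 (z / (z - 1)))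
    (G := fun z =>
      nielsenS 2 1 z * Complex.log (1 - z) + nielsenS 2 2 z
      - (1 / 2) * (nielsenS 1 1 z * Complex.log (1 - z) ^ 2)
      - nielsenS 1 2 z * Complex.log (1 - z) - nielsenS 1 3 z - nielsenS 3 1 z
      - (1 / 24) * Complex.log (1 - z) ^ 4)
    (fun w hw => ?_) ?_ ?_ hz
  · have hr := cutPlane_subset_rayCutPlane hw
    have h0 := ne_zero_of_mem_cutPlane hw
    have hb := hasDerivAt_log_one_sub hr
    refine HasDerivAt.congr_deriv
      ((hasDerivAt_nielsenS_div_sub_one 1 hw).fun_sub ((((((((hasDerivAt_nielsenS_succ 0 0 hr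
      h0).fun_mul hb).fun_add (hasDerivAt_nielsenS_succ 0 1 hr h0)).fun_sub
      (((hasDerivAt_nielsenS_one_one hr h0).fun_mul (hb.fun_pow 2)).const_mul _)).fun_sub
      ((hasDerivAt_nielsenS_one_two hr h0).fun_mul hb)).fun_sub (hasDerivAt_nielsenS_one_three hr
      h0)).fun_sub (hasDerivAt_nielsenS_succ 1 0 hr h0)).fun_sub ((hb.fun_pow 4).const_mul _))) ?_
    push_cast
    linear_combination 1 / w * landen_trilogarithm hw + 1 / (1 - w) * landen_trilogarithm hw
  · exact (logSmall_nielsenS_div_sub_one 3 0).tendsto_zero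
  · exact
      (LogSmall.sub (LogSmall.sub (LogSmall.sub (LogSmall.sub (LogSmall.sub (LogSmall.add
      (LogSmall.mul (logSmall_nielsenS 2 0) logSmall_log_one_sub) (logSmall_nielsenS 2 1))
      (LogSmall.const_mul _ (LogSmall.mul (logSmall_nielsenS 1 0) (logSmall_log_one_sub.pow_succ
      1)))) (LogSmall.mul (logSmall_nielsenS 1 1) logSmall_log_one_sub)) (logSmall_nielsenS 1 2))
      (logSmall_nielsenS 3 0)) (LogSmall.const_mul _ (logSmall_log_one_sub.pow_succ 3)))

theorem reflection_tetralogarithm {z : ℂ} (hz : z ∈ cutPlane) :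
    nielsenS 3 1 (1 - z) - riemannZeta 4 =
      nielsenS 3 1 z + nielsenS 3 1 (z / (z - 1)) + (1 / 24) * Complex.log (1 - z) ^ 4
      + (1 / 2 * riemannZeta 2) * Complex.log (1 - z) ^ 2 + (riemannZeta 3) * Complex.log (1 - z)
      - nielsenS 2 1 z * Complex.log (1 - z) - nielsenS 2 2 z
      - (1 / 6) * (Complex.log z * Complex.log (1 - z) ^ 3) := by
  refine eq_of_hasDerivAt_sub_of_logSmall (F := fun z => nielsenS 3 1 (1 - z) - riemannZeta 4)
    (G := fun z =>
      nielsenS 3 1 z + nielsenS 3 1 (z / (z - 1)) + (1 / 24) * Complex.log (1 - z) ^ 4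
      + (1 / 2 * riemannZeta 2) * Complex.log (1 - z) ^ 2 + (riemannZeta 3) * Complex.log (1 - z)
      - nielsenS 2 1 z * Complex.log (1 - z) - nielsenS 2 2 z
      - (1 / 6) * (Complex.log z * Complex.log (1 - z) ^ 3))
    (fun w hw => ?_) ?_ ?_ hz
  · have hr := cutPlane_subset_rayCutPlane hw
    have h0 := ne_zero_of_mem_cutPlane hw
    have ha := hasDerivAt_log_of_mem_cutPlane hw
    have hb := hasDerivAt_log_one_sub hr
    refine HasDerivAt.congr_deriv
      (((hasDerivAt_nielsenS_one_sub 1 0 hw).sub_const _).fun_sub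
      ((((((((hasDerivAt_nielsenS_succ 1 0 hr h0).fun_add (hasDerivAt_nielsenS_div_sub_one 1
      hw)).fun_add ((hb.fun_pow 4).const_mul _)).fun_add ((hb.fun_pow 2).const_mul _)).fun_add
      (hb.const_mul _)).fun_sub ((hasDerivAt_nielsenS_succ 0 0 hr h0).fun_mul hb)).fun_sub
      (hasDerivAt_nielsenS_succ 0 1 hr h0)).fun_sub ((ha.fun_mul (hb.fun_pow 3)).const_mul _))) ?_
    push_cast
    linear_combination -(1 / w) * landen_trilogarithm hw + -(1 / (1 - w)) * reflection_trilogarithm hw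
  · simpa using (tendsto_nielsenS_one_one_sub 2).sub_const (riemannZeta 4)
  · exact
      (LogSmall.sub (LogSmall.sub (LogSmall.sub (LogSmall.add (LogSmall.add (LogSmall.add
      (LogSmall.add (logSmall_nielsenS 3 0) (logSmall_nielsenS_div_sub_one 3 0))
      (LogSmall.const_mul _ (logSmall_log_one_sub.pow_succ 3))) (LogSmall.const_mul _
      (logSmall_log_one_sub.pow_succ 1))) (LogSmall.const_mul _ logSmall_log_one_sub))
      (LogSmall.mul (logSmall_nielsenS 2 0) logSmall_log_one_sub)) (logSmall_nielsenS 2 1))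
      (LogSmall.const_mul _ (LogSmall.log_mul (logSmall_log_one_sub.pow_succ 2))))

theorem logSmall_nielsenS_three_one_one_sub :
    LogSmall fun x => nielsenS 3 1 (1 - (x : ℂ)) - riemannZeta 4 := by
  refine LogSmall.congr_cutPlane (F := fun z =>
      nielsenS 3 1 z + nielsenS 3 1 (z / (z - 1)) + (1 / 24) * Complex.log (1 - z) ^ 4
      + (1 / 2 * riemannZeta 2) * Complex.log (1 - z) ^ 2 + (riemannZeta 3) * Complex.log (1 - z)
      - nielsenS 2 1 z * Complex.log (1 - z) - nielsenS 2 2 z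
      - (1 / 6) * (Complex.log z * Complex.log (1 - z) ^ 3))
    (G := fun z => nielsenS 3 1 (1 - z) - riemannZeta 4) ?_ fun _ hz => reflection_tetralogarithm hz
  exact
    (LogSmall.sub (LogSmall.sub (LogSmall.sub (LogSmall.add (LogSmall.add (LogSmall.add
    (LogSmall.add (logSmall_nielsenS 3 0) (logSmall_nielsenS_div_sub_one 3 0))
    (LogSmall.const_mul _ (logSmall_log_one_sub.pow_succ 3))) (LogSmall.const_mul _
    (logSmall_log_one_sub.pow_succ 1))) (LogSmall.const_mul _ logSmall_log_one_sub))
    (LogSmall.mul (logSmall_nielsenS 2 0) logSmall_log_one_sub)) (logSmall_nielsenS 2 1))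
    (LogSmall.const_mul _ (LogSmall.log_mul (logSmall_log_one_sub.pow_succ 2))))

theorem nielsenS_two_two_reflection {z : ℂ} (hz : z ∈ cutPlane) :
    nielsenS 2 2 (1 - z) - 1 / 4 * riemannZeta 4 =
      (nielsenS 3 1 (1 - z) - riemannZeta 4)
      + (1 / 6) * (Complex.log z * Complex.log (1 - z) ^ 3)
      + (riemannZeta 2) * (Complex.log z * Complex.log (1 - z))
      - Complex.log z * (nielsenS 2 1 (1 - z) - riemannZeta 3) - nielsenS 3 1 z
      - nielsenS 3 1 (z / (z - 1)) - (1 / 4) * (Complex.log z ^ 2 * Complex.log (1 - z) ^ 2)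
      - (1 / 24) * Complex.log (1 - z) ^ 4 - (1 / 2 * riemannZeta 2) * Complex.log (1 - z) ^ 2 := by
  refine eq_of_hasDerivAt_sub_of_logSmall (F := fun z => nielsenS 2 2 (1 - z) - 1 / 4 * riemannZeta 4)
    (G := fun z =>
      (nielsenS 3 1 (1 - z) - riemannZeta 4)
      + (1 / 6) * (Complex.log z * Complex.log (1 - z) ^ 3)
      + (riemannZeta 2) * (Complex.log z * Complex.log (1 - z))
      - Complex.log z * (nielsenS 2 1 (1 - z) - riemannZeta 3) - nielsenS 3 1 z
      - nielsenS 3 1 (z / (z - 1)) - (1 / 4) * (Complex.log z ^ 2 * Complex.log (1 - z) ^ 2)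
      - (1 / 24) * Complex.log (1 - z) ^ 4 - (1 / 2 * riemannZeta 2) * Complex.log (1 - z) ^ 2)
    (fun w hw => ?_) ?_ ?_ hz
  · have hr := cutPlane_subset_rayCutPlane hw
    have h0 := ne_zero_of_mem_cutPlane hw
    have ha := hasDerivAt_log_of_mem_cutPlane hw
    have hb := hasDerivAt_log_one_sub hr
    refine HasDerivAt.congr_deriv
      (((hasDerivAt_nielsenS_one_sub 0 1 hw).sub_const _).fun_sub
      ((((((((((hasDerivAt_nielsenS_one_sub 1 0 hw).sub_const _).fun_add ((ha.fun_mul (hb.fun_pow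
      3)).const_mul _)).fun_add ((ha.fun_mul hb).const_mul _)).fun_sub (ha.fun_mul
      ((hasDerivAt_nielsenS_one_sub 0 0 hw).sub_const _))).fun_sub (hasDerivAt_nielsenS_succ 1 0
      hr h0)).fun_sub (hasDerivAt_nielsenS_div_sub_one 1 hw)).fun_sub (((ha.fun_pow 2).fun_mul
      (hb.fun_pow 2)).const_mul _)).fun_sub ((hb.fun_pow 4).const_mul _)).fun_sub ((hb.fun_pow
      2).const_mul _))) ?_
    push_cast
    linear_combination 1 / w * reflection_trilogarithm hw + -(1 / (1 - w)) * nielsenS_one_two_reflection hw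
  · simpa using tendsto_nielsenS_two_two_one_sub.sub_const (1 / 4 * riemannZeta 4)
  · exact
      (LogSmall.sub (LogSmall.sub (LogSmall.sub (LogSmall.sub (LogSmall.sub (LogSmall.sub
      (LogSmall.add (LogSmall.add logSmall_nielsenS_three_one_one_sub (LogSmall.const_mul _
      (LogSmall.log_mul (logSmall_log_one_sub.pow_succ 2)))) (LogSmall.const_mul _
      (LogSmall.log_mul logSmall_log_one_sub))) (LogSmall.log_mul
      logSmall_nielsenS_two_one_one_sub)) (logSmall_nielsenS 3 0)) (logSmall_nielsenS_div_sub_one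
      3 0)) (LogSmall.const_mul _ (LogSmall.log_pow_mul 2 (logSmall_log_one_sub.pow_succ 1))))
      (LogSmall.const_mul _ (logSmall_log_one_sub.pow_succ 3))) (LogSmall.const_mul _
      (logSmall_log_one_sub.pow_succ 1)))

theorem reflection_pentalogarithm {z : ℂ} (hz : z ∈ cutPlane) :
    nielsenS 4 1 (1 - z) - riemannZeta 5 =
      nielsenS 3 1 z * Complex.log (1 - z) + nielsenS 3 2 z + (1 / 120) * Complex.log (1 - z) ^ 5
      + (1 / 6 * riemannZeta 2) * Complex.log (1 - z) ^ 3
      + (1 / 2 * riemannZeta 3) * Complex.log (1 - z) ^ 2 + (riemannZeta 4) * Complex.log (1 - z)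
      - (1 / 2) * (nielsenS 2 1 z * Complex.log (1 - z) ^ 2)
      - nielsenS 2 2 z * Complex.log (1 - z) - nielsenS 2 3 z - nielsenS 4 1 z
      - nielsenS 4 1 (z / (z - 1)) - (1 / 24) * (Complex.log z * Complex.log (1 - z) ^ 4) := by
  refine eq_of_hasDerivAt_sub_of_logSmall (F := fun z => nielsenS 4 1 (1 - z) - riemannZeta 5)
    (G := fun z =>
      nielsenS 3 1 z * Complex.log (1 - z) + nielsenS 3 2 z + (1 / 120) * Complex.log (1 - z) ^ 5
      + (1 / 6 * riemannZeta 2) * Complex.log (1 - z) ^ 3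
      + (1 / 2 * riemannZeta 3) * Complex.log (1 - z) ^ 2 + (riemannZeta 4) * Complex.log (1 - z)
      - (1 / 2) * (nielsenS 2 1 z * Complex.log (1 - z) ^ 2)
      - nielsenS 2 2 z * Complex.log (1 - z) - nielsenS 2 3 z - nielsenS 4 1 z
      - nielsenS 4 1 (z / (z - 1)) - (1 / 24) * (Complex.log z * Complex.log (1 - z) ^ 4))
    (fun w hw => ?_) ?_ ?_ hz
  · have hr := cutPlane_subset_rayCutPlane hw
    have h0 := ne_zero_of_mem_cutPlane hw
    have ha := hasDerivAt_log_of_mem_cutPlane hw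
    have hb := hasDerivAt_log_one_sub hr
    refine HasDerivAt.congr_deriv
      (((hasDerivAt_nielsenS_one_sub 2 0 hw).sub_const _).fun_sub
      (((((((((((((hasDerivAt_nielsenS_succ 1 0 hr h0).fun_mul hb).fun_add
      (hasDerivAt_nielsenS_succ 1 1 hr h0)).fun_add ((hb.fun_pow 5).const_mul _)).fun_add
      ((hb.fun_pow 3).const_mul _)).fun_add ((hb.fun_pow 2).const_mul _)).fun_add (hb.const_mul
      _)).fun_sub (((hasDerivAt_nielsenS_succ 0 0 hr h0).fun_mul (hb.fun_pow 2)).const_mul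
      _)).fun_sub ((hasDerivAt_nielsenS_succ 0 1 hr h0).fun_mul hb)).fun_sub
      (hasDerivAt_nielsenS_succ 0 2 hr h0)).fun_sub (hasDerivAt_nielsenS_succ 2 0 hr h0)).fun_sub
      (hasDerivAt_nielsenS_div_sub_one 2 hw)).fun_sub ((ha.fun_mul (hb.fun_pow 4)).const_mul _))) ?_
    push_cast
    -- Both poles carry `Li_4(w/(w-1))`: the Landen formula removes it at 1/w, the reflection
    -- formula at 1/(1-w).
    linear_combination 1 / w * landen_tetralogarithm hw + -(1 / (1 - w)) * reflection_tetralogarithm hw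
  · simpa using (tendsto_nielsenS_one_one_sub 3).sub_const (riemannZeta 5)
  · exact
      (LogSmall.sub (LogSmall.sub (LogSmall.sub (LogSmall.sub (LogSmall.sub (LogSmall.sub
      (LogSmall.add (LogSmall.add (LogSmall.add (LogSmall.add (LogSmall.add (LogSmall.mul
      (logSmall_nielsenS 3 0) logSmall_log_one_sub) (logSmall_nielsenS 3 1)) (LogSmall.const_mul
      _ (logSmall_log_one_sub.pow_succ 4))) (LogSmall.const_mul _ (logSmall_log_one_sub.pow_succ
      2))) (LogSmall.const_mul _ (logSmall_log_one_sub.pow_succ 1))) (LogSmall.const_mul _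
      logSmall_log_one_sub)) (LogSmall.const_mul _ (LogSmall.mul (logSmall_nielsenS 2 0)
      (logSmall_log_one_sub.pow_succ 1)))) (LogSmall.mul (logSmall_nielsenS 2 1)
      logSmall_log_one_sub)) (logSmall_nielsenS 2 2)) (logSmall_nielsenS 4 0))
      (logSmall_nielsenS_div_sub_one 4 0)) (LogSmall.const_mul _ (LogSmall.log_mul
      (logSmall_log_one_sub.pow_succ 3))))

theorem logSmall_nielsenS_four_one_one_sub :
    LogSmall fun x => nielsenS 4 1 (1 - (x : ℂ)) - riemannZeta 5 := by
  refine LogSmall.congr_cutPlane (F := fun z =>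
      nielsenS 3 1 z * Complex.log (1 - z) + nielsenS 3 2 z + (1 / 120) * Complex.log (1 - z) ^ 5
      + (1 / 6 * riemannZeta 2) * Complex.log (1 - z) ^ 3
      + (1 / 2 * riemannZeta 3) * Complex.log (1 - z) ^ 2 + (riemannZeta 4) * Complex.log (1 - z)
      - (1 / 2) * (nielsenS 2 1 z * Complex.log (1 - z) ^ 2)
      - nielsenS 2 2 z * Complex.log (1 - z) - nielsenS 2 3 z - nielsenS 4 1 z
      - nielsenS 4 1 (z / (z - 1)) - (1 / 24) * (Complex.log z * Complex.log (1 - z) ^ 4))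
    (G := fun z => nielsenS 4 1 (1 - z) - riemannZeta 5) ?_ fun _ hz => reflection_pentalogarithm hz
  exact
    (LogSmall.sub (LogSmall.sub (LogSmall.sub (LogSmall.sub (LogSmall.sub (LogSmall.sub
    (LogSmall.add (LogSmall.add (LogSmall.add (LogSmall.add (LogSmall.add (LogSmall.mul
    (logSmall_nielsenS 3 0) logSmall_log_one_sub) (logSmall_nielsenS 3 1)) (LogSmall.const_mul _
    (logSmall_log_one_sub.pow_succ 4))) (LogSmall.const_mul _ (logSmall_log_one_sub.pow_succ 2)))
    (LogSmall.const_mul _ (logSmall_log_one_sub.pow_succ 1))) (LogSmall.const_mul _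
    logSmall_log_one_sub)) (LogSmall.const_mul _ (LogSmall.mul (logSmall_nielsenS 2 0)
    (logSmall_log_one_sub.pow_succ 1)))) (LogSmall.mul (logSmall_nielsenS 2 1)
    logSmall_log_one_sub)) (logSmall_nielsenS 2 2)) (logSmall_nielsenS 4 0))
    (logSmall_nielsenS_div_sub_one 4 0)) (LogSmall.const_mul _ (LogSmall.log_mul
    (logSmall_log_one_sub.pow_succ 3))))

/-- The coefficient (3/4)ζ(4) is ζ(4) - (1/4)ζ(4), the difference of the values of `Li_4` and
`S_{2,2}` at 1. In weight 4 the corresponding term is absent because `Li_3` and `S_{1,2}` agree at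
1. -/
theorem nielsenS_three_two_reflection {z : ℂ} (hz : z ∈ cutPlane) :
    nielsenS 3 2 (1 - z) - (2 * riemannZeta 5 - riemannZeta 2 * riemannZeta 3) =
      (nielsenS 4 1 (1 - z) - riemannZeta 5) + nielsenS 4 1 z + nielsenS 4 1 (z / (z - 1))
      + (1 / 24) * (Complex.log z * Complex.log (1 - z) ^ 4)
      + (1 / 2 * riemannZeta 2) * (Complex.log z * Complex.log (1 - z) ^ 2)
      + (riemannZeta 3) * (Complex.log z * Complex.log (1 - z))
      - Complex.log z * (nielsenS 3 1 (1 - z) - riemannZeta 4)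
      - nielsenS 3 1 z * Complex.log (1 - z) - nielsenS 3 2 z
      - (1 / 12) * (Complex.log z ^ 2 * Complex.log (1 - z) ^ 3)
      - (1 / 120) * Complex.log (1 - z) ^ 5 - (1 / 6 * riemannZeta 2) * Complex.log (1 - z) ^ 3
      - (3 / 4 * riemannZeta 4) * Complex.log (1 - z) := by
  refine eq_of_hasDerivAt_sub_of_logSmall (F := fun z => nielsenS 3 2 (1 - z) - (2 * riemannZeta 5 - riemannZeta 2 * riemannZeta 3))
    (G := fun z =>
      (nielsenS 4 1 (1 - z) - riemannZeta 5) + nielsenS 4 1 z + nielsenS 4 1 (z / (z - 1))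
      + (1 / 24) * (Complex.log z * Complex.log (1 - z) ^ 4)
      + (1 / 2 * riemannZeta 2) * (Complex.log z * Complex.log (1 - z) ^ 2)
      + (riemannZeta 3) * (Complex.log z * Complex.log (1 - z))
      - Complex.log z * (nielsenS 3 1 (1 - z) - riemannZeta 4)
      - nielsenS 3 1 z * Complex.log (1 - z) - nielsenS 3 2 z
      - (1 / 12) * (Complex.log z ^ 2 * Complex.log (1 - z) ^ 3)
      - (1 / 120) * Complex.log (1 - z) ^ 5 - (1 / 6 * riemannZeta 2) * Complex.log (1 - z) ^ 3
      - (3 / 4 * riemannZeta 4) * Complex.log (1 - z))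
    (fun w hw => ?_) ?_ ?_ hz
  · have hr := cutPlane_subset_rayCutPlane hw
    have h0 := ne_zero_of_mem_cutPlane hw
    have ha := hasDerivAt_log_of_mem_cutPlane hw
    have hb := hasDerivAt_log_one_sub hr
    refine HasDerivAt.congr_deriv
      (((hasDerivAt_nielsenS_one_sub 1 1 hw).sub_const _).fun_sub
      ((((((((((((((hasDerivAt_nielsenS_one_sub 2 0 hw).sub_const _).fun_add
      (hasDerivAt_nielsenS_succ 2 0 hr h0)).fun_add (hasDerivAt_nielsenS_div_sub_one 2
      hw)).fun_add ((ha.fun_mul (hb.fun_pow 4)).const_mul _)).fun_add ((ha.fun_mul (hb.fun_pow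
      2)).const_mul _)).fun_add ((ha.fun_mul hb).const_mul _)).fun_sub (ha.fun_mul
      ((hasDerivAt_nielsenS_one_sub 1 0 hw).sub_const _))).fun_sub ((hasDerivAt_nielsenS_succ 1 0
      hr h0).fun_mul hb)).fun_sub (hasDerivAt_nielsenS_succ 1 1 hr h0)).fun_sub (((ha.fun_pow
      2).fun_mul (hb.fun_pow 3)).const_mul _)).fun_sub ((hb.fun_pow 5).const_mul _)).fun_sub
      ((hb.fun_pow 3).const_mul _)).fun_sub (hb.const_mul _))) ?_
    push_cast
    linear_combination 1 / w * reflection_tetralogarithm hw + -(1 / (1 - w)) * nielsenS_two_two_reflection hw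
  · simpa using tendsto_nielsenS_three_two_one_sub.sub_const (2 * riemannZeta 5 - riemannZeta 2 * riemannZeta 3)
  · exact
      (LogSmall.sub (LogSmall.sub (LogSmall.sub (LogSmall.sub (LogSmall.sub (LogSmall.sub
      (LogSmall.sub (LogSmall.add (LogSmall.add (LogSmall.add (LogSmall.add (LogSmall.add
      logSmall_nielsenS_four_one_one_sub (logSmall_nielsenS 4 0)) (logSmall_nielsenS_div_sub_one
      4 0)) (LogSmall.const_mul _ (LogSmall.log_mul (logSmall_log_one_sub.pow_succ 3))))
      (LogSmall.const_mul _ (LogSmall.log_mul (logSmall_log_one_sub.pow_succ 1))))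
      (LogSmall.const_mul _ (LogSmall.log_mul logSmall_log_one_sub))) (LogSmall.log_mul
      logSmall_nielsenS_three_one_one_sub)) (LogSmall.mul (logSmall_nielsenS 3 0)
      logSmall_log_one_sub)) (logSmall_nielsenS 3 1)) (LogSmall.const_mul _ (LogSmall.log_pow_mul
      2 (logSmall_log_one_sub.pow_succ 2)))) (LogSmall.const_mul _ (logSmall_log_one_sub.pow_succ
      4))) (LogSmall.const_mul _ (logSmall_log_one_sub.pow_succ 2))) (LogSmall.const_mul _
      logSmall_log_one_sub))

/-- Only the difference of `S_{4,2}(1-z)` and `Li_6(1-z)` is needed: its derivative involves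
`S_{3,2}(1-z) - Li_5(1-z)`, exactly what the weight 5 relation for `S_{3,2}` supplies. The
derivative of `log z * (Li_5(1-z) - ζ(5))` calls for the `Li_5` reflection formula, whose
`S_{2,3}(z)` term matches the derivative of `S_{3,3}(z)`. The additive constant is ζ(6) -
`S_{4,2}(1)`. -/
theorem nielsenS_four_two_reflection {z : ℂ} (hz : z ∈ cutPlane) :
    nielsenS 4 2 (1 - z) - nielsenS 5 1 (1 - z) + (1 / 4 * riemannZeta 6 + 1 / 2 * riemannZeta 3 ^ 2) =
      nielsenS 4 1 z * Complex.log (1 - z) + nielsenS 4 2 z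
      + (1 / 120) * (Complex.log z * Complex.log (1 - z) ^ 5)
      + (1 / 6 * riemannZeta 2) * (Complex.log z * Complex.log (1 - z) ^ 3)
      + (1 / 2 * riemannZeta 3) * (Complex.log z * Complex.log (1 - z) ^ 2)
      + (riemannZeta 4) * (Complex.log z * Complex.log (1 - z))
      + (riemannZeta 5) * Complex.log (1 - z)
      - Complex.log z * (nielsenS 4 1 (1 - z) - riemannZeta 5)
      - (1 / 2) * (nielsenS 3 1 z * Complex.log (1 - z) ^ 2)
      - nielsenS 3 2 z * Complex.log (1 - z) - nielsenS 3 3 z - nielsenS 5 1 z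
      - nielsenS 5 1 (z / (z - 1)) - (1 / 48) * (Complex.log z ^ 2 * Complex.log (1 - z) ^ 4)
      - (1 / 720) * Complex.log (1 - z) ^ 6 - (1 / 24 * riemannZeta 2) * Complex.log (1 - z) ^ 4
      - (3 / 8 * riemannZeta 4) * Complex.log (1 - z) ^ 2
      - (riemannZeta 2 * riemannZeta 3) * Complex.log (1 - z) := by
  refine eq_of_hasDerivAt_sub_of_logSmall (F := fun z => nielsenS 4 2 (1 - z) - nielsenS 5 1 (1 - z) + (1 / 4 * riemannZeta 6 + 1 / 2 * riemannZeta 3 ^ 2))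
    (G := fun z =>
      nielsenS 4 1 z * Complex.log (1 - z) + nielsenS 4 2 z
      + (1 / 120) * (Complex.log z * Complex.log (1 - z) ^ 5)
      + (1 / 6 * riemannZeta 2) * (Complex.log z * Complex.log (1 - z) ^ 3)
      + (1 / 2 * riemannZeta 3) * (Complex.log z * Complex.log (1 - z) ^ 2)
      + (riemannZeta 4) * (Complex.log z * Complex.log (1 - z))
      + (riemannZeta 5) * Complex.log (1 - z)
      - Complex.log z * (nielsenS 4 1 (1 - z) - riemannZeta 5)
      - (1 / 2) * (nielsenS 3 1 z * Complex.log (1 - z) ^ 2)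
      - nielsenS 3 2 z * Complex.log (1 - z) - nielsenS 3 3 z - nielsenS 5 1 z
      - nielsenS 5 1 (z / (z - 1)) - (1 / 48) * (Complex.log z ^ 2 * Complex.log (1 - z) ^ 4)
      - (1 / 720) * Complex.log (1 - z) ^ 6 - (1 / 24 * riemannZeta 2) * Complex.log (1 - z) ^ 4
      - (3 / 8 * riemannZeta 4) * Complex.log (1 - z) ^ 2
      - (riemannZeta 2 * riemannZeta 3) * Complex.log (1 - z))
    (fun w hw => ?_) ?_ ?_ hz
  · have hr := cutPlane_subset_rayCutPlane hw
    have h0 := ne_zero_of_mem_cutPlane hw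
    have ha := hasDerivAt_log_of_mem_cutPlane hw
    have hb := hasDerivAt_log_one_sub hr
    refine HasDerivAt.congr_deriv
      ((((hasDerivAt_nielsenS_one_sub 2 1 hw).fun_sub (hasDerivAt_nielsenS_one_sub 3 0
      hw)).add_const _).fun_sub (((((((((((((((((((hasDerivAt_nielsenS_succ 2 0 hr h0).fun_mul
      hb).fun_add (hasDerivAt_nielsenS_succ 2 1 hr h0)).fun_add ((ha.fun_mul (hb.fun_pow
      5)).const_mul _)).fun_add ((ha.fun_mul (hb.fun_pow 3)).const_mul _)).fun_add ((ha.fun_mul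
      (hb.fun_pow 2)).const_mul _)).fun_add ((ha.fun_mul hb).const_mul _)).fun_add (hb.const_mul
      _)).fun_sub (ha.fun_mul ((hasDerivAt_nielsenS_one_sub 2 0 hw).sub_const _))).fun_sub
      (((hasDerivAt_nielsenS_succ 1 0 hr h0).fun_mul (hb.fun_pow 2)).const_mul _)).fun_sub
      ((hasDerivAt_nielsenS_succ 1 1 hr h0).fun_mul hb)).fun_sub (hasDerivAt_nielsenS_succ 1 2 hr
      h0)).fun_sub (hasDerivAt_nielsenS_succ 3 0 hr h0)).fun_sub (hasDerivAt_nielsenS_div_sub_one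
      3 hw)).fun_sub (((ha.fun_pow 2).fun_mul (hb.fun_pow 4)).const_mul _)).fun_sub ((hb.fun_pow
      6).const_mul _)).fun_sub ((hb.fun_pow 4).const_mul _)).fun_sub ((hb.fun_pow 2).const_mul
      _)).fun_sub (hb.const_mul _))) ?_
    push_cast
    linear_combination 1 / w * reflection_pentalogarithm hw + -(1 / (1 - w)) * nielsenS_three_two_reflection hw
  · have h := (tendsto_nielsenS_four_two_one_sub.sub (tendsto_nielsenS_one_one_sub 4)).add_const
      (1 / 4 * riemannZeta 6 + 1 / 2 * riemannZeta 3 ^ 2)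
    convert! h using 2
    push_cast
    ring
  · exact
      (LogSmall.sub (LogSmall.sub (LogSmall.sub (LogSmall.sub (LogSmall.sub (LogSmall.sub
      (LogSmall.sub (LogSmall.sub (LogSmall.sub (LogSmall.sub (LogSmall.sub (LogSmall.add
      (LogSmall.add (LogSmall.add (LogSmall.add (LogSmall.add (LogSmall.add (LogSmall.mul
      (logSmall_nielsenS 4 0) logSmall_log_one_sub) (logSmall_nielsenS 4 1)) (LogSmall.const_mul
      _ (LogSmall.log_mul (logSmall_log_one_sub.pow_succ 4)))) (LogSmall.const_mul _
      (LogSmall.log_mul (logSmall_log_one_sub.pow_succ 2)))) (LogSmall.const_mul _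
      (LogSmall.log_mul (logSmall_log_one_sub.pow_succ 1)))) (LogSmall.const_mul _
      (LogSmall.log_mul logSmall_log_one_sub))) (LogSmall.const_mul _ logSmall_log_one_sub))
      (LogSmall.log_mul logSmall_nielsenS_four_one_one_sub)) (LogSmall.const_mul _ (LogSmall.mul
      (logSmall_nielsenS 3 0) (logSmall_log_one_sub.pow_succ 1)))) (LogSmall.mul
      (logSmall_nielsenS 3 1) logSmall_log_one_sub)) (logSmall_nielsenS 3 2)) (logSmall_nielsenS
      5 0)) (logSmall_nielsenS_div_sub_one 5 0)) (LogSmall.const_mul _ (LogSmall.log_pow_mul 2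
      (logSmall_log_one_sub.pow_succ 3)))) (LogSmall.const_mul _ (logSmall_log_one_sub.pow_succ
      5))) (LogSmall.const_mul _ (logSmall_log_one_sub.pow_succ 3))) (LogSmall.const_mul _
      (logSmall_log_one_sub.pow_succ 1))) (LogSmall.const_mul _ logSmall_log_one_sub))

end FunctionalEquations
theorem mainTheorem8 (z : ℂ) (hz : z ∈ cutPlane) :
    nielsenS 3 3 z =
      nielsenS 4 2 z - nielsenS 4 2 (1 - z)
      + classicalLi 6 (1 - z) - classicalLi 6 z - classicalLi 6 (z / (z - 1))
      - nielsenS 3 2 z * Complex.log (1 - z)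
      + classicalLi 5 z * Complex.log (1 - z)
      - classicalLi 5 (1 - z) * Complex.log z
      - 1 / (Nat.factorial 2 : ℂ) * classicalLi 4 z * Complex.log (1 - z) ^ 2
      - 1 / (Nat.factorial 6 : ℂ) * Complex.log (1 - z) ^ 6
      + 1 / (Nat.factorial 5 : ℂ) * Complex.log z * Complex.log (1 - z) ^ 5
      - 1 / ((Nat.factorial 2 : ℂ) * (Nat.factorial 4 : ℂ)) *
          Complex.log z ^ 2 * Complex.log (1 - z) ^ 4
      - 1 / (Nat.factorial 4 : ℂ) * riemannZeta 2 * Complex.log (1 - z) ^ 4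
      + 1 / (Nat.factorial 3 : ℂ) * riemannZeta 2 * Complex.log z * Complex.log (1 - z) ^ 3
      + 1 / (Nat.factorial 2 : ℂ) * riemannZeta 3 * Complex.log z * Complex.log (1 - z) ^ 2
      + riemannZeta 4 * Complex.log z * Complex.log (1 - z)
      - 3 / (4 * (Nat.factorial 2 : ℂ)) * riemannZeta 4 * Complex.log (1 - z) ^ 2
      + riemannZeta 5 * Complex.log z
      + (riemannZeta 5 - riemannZeta 2 * riemannZeta 3) * Complex.log (1 - z)
      - (1 / 4 * riemannZeta 6 + 1 / 2 * riemannZeta 3 ^ 2) := by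
  have hr := cutPlane_subset_rayCutPlane hz
  have hr' := cutPlane_subset_rayCutPlane (one_sub_mem_cutPlane hz)
  rw [classicalLi_eq_nielsenS 4 hr', classicalLi_eq_nielsenS 4 hr,
    classicalLi_eq_nielsenS 4 (div_sub_one_mem_rayCutPlane hr), classicalLi_eq_nielsenS 3 hr,
    classicalLi_eq_nielsenS 3 hr', classicalLi_eq_nielsenS 2 hr]
  simp only [Nat.factorial, Nat.succ_eq_add_one]
  push_cast
  -- `S_{3,3}(z)` occurs linearly with coefficient -1 in the weight 6 relation, so the theorem is a
  -- rearrangement.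
  linear_combination nielsenS_four_two_reflection hz
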